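/- Let $P$ be a nonempty set of $m$ points in general position in the plane (no three on a line), $m$ even, and let $\chi$ be a 2-coloring of the edges (segments between two points) of $P$. For $p\in P$ let $L(p)$ and $S(p)$ be the larger and the smaller color class among the $m-1$ edges at $p$. For an edge $e=(p,q)$ let $\ell_e$ be its line, directed from $q$ to $p$, and let $L_l(p)$, $L_r(p)$ be the numbers of edges of $L(p)$ to the left and to the right of $\ell_e$; $e$ is a $\chi$-halving edge of $p$ if $|L_l(p)-L_r(p)|\le 1$. A $\chi$-halving matching assigns to each $p\in P$ one of its $\chi$-halving edges, no edge being assigned to two points. Let $\overline{\mathrm{cr}}_2(P,\chi)$ be the number of pairs of crossing edges of equal color, and $\overline{\mathrm{cr}}_2(K_n)$ the minimum of this number over all sets of $n$ points in general position and all 2-colorings of their edges. Duplication. Given $P$, $\chi$ and a $\chi$-halving matching, replace every point $p$, with matching edge $e=(p,q)$, by two points $p_1,p_2$ on $\ell_e$ in a small neighborhood of $p$, such that they lie on different sides of the line of every other edge at $p$, on the same side as $p$ of the line of every edge not incident to $p$, and $p_1$ is further from $q$ than $p_2$; the neighborhoods are so small that replacing three distinct points by duplicates of them never changes the orientation of the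 triple. Edges between a duplicate of $p$ and a duplicate of $p'\neq p$ inherit the color of $(p,p')$. Let $q_L$ and $q_R$ be the duplicates of $q$ to the left and to the right of $\ell_e$. The edge $(p_1,p_2)$ gets the color of $L(p)$ if $e\in S(p)$ and $L_l(p)\ne L_r(p)$, and the color of $S(p)$ otherwise. The edges matched with $p_1$ and $p_2$ are, respectively: if $e\in S(p)$, $(p_1,q_L),(p_2,q_R)$ when $L_l(p)>L_r(p)$; $(p_1,p_2),(p_2,q_R)$ when $L_l(p)=L_r(p)$; $(p_1,q_R),(p_2,q_L)$ when $L_l(p)<L_r(p)$; and if $e\in L(p)$, $(p_1,q_L),(p_2,q_L)$ when $L_l(p)>L_r(p)$; $(p_1,p_2),(p_2,q_L)$ when $L_l(p)=L_r(p)$; $(p_1,q_R),(p_2,q_R)$ when $L_l(p)<L_r(p)$. Theorem. Suppose $P$ has a $\chi$-halving matching. Then the duplication can be iterated forever, starting from $P$, $\chi$ and this matching, and there are rational numbers $A,B,C,D$, depending only on $P$, $\chi$ and the matching, such that, for every choice of the duplicates, the colored point set $(Q_k,\chi_k)$ obtained after $k\ge1$ steps satisfies $$\overline{\mathrm{cr}}_2(Q_k,\chi_k)=A\cdot2^{4k}+B\cdot2^{3k}+C\cdot2^{2k}+D\cdot2^{k}.$$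 (In particular this determines $A$.) With this $A$, $$\overline{\mathrm{cr}}_2(K_n)\le\frac{24A}{m^4}\binom n4+\Theta(n^3),$$ that is, there is a function $f(n)=\Theta(n^3)$ with $\overline{\mathrm{cr}}_2(K_n)\le\frac{24A}{m^4}\binom n4+f(n)$ for all $n\ge 0$. -/

import Mathlib

open Asymptotics Filter

/-- The Euclidean plane. -/
abbrev Plane : Type := EuclideanSpace ℝ (Fin 2)

/-- Twice the signed area of the triangle `a b x`.  It is positive iff `x` lies strictly to the left
of the line through `a` and `b` directed from `a` to `b`, and negative iff `x` lies strictly to the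
right of it. -/
noncomputable def side (a b x : Plane) : ℝ :=
  (b 0 - a 0) * (x 1 - a 1) - (b 1 - a 1) * (x 0 - a 0)

section

variable {V : Type}

/-- The labelled points are distinct and no three of them lie on a line. -/
def GeneralPosition (P : V → Plane) : Prop :=
  Function.Injective P ∧
    ∀ p q r : V, p ≠ q → p ≠ r → q ≠ r → ¬ Collinear ℝ {P p, P q, P r}

/-- `cr̄₂(P, χ)`: the number of unordered pairs of distinct edges of the complete straight-line
drawing on `P` that have the same colour and cross (have a common interior point).  An edge is
`s(p, q)` with `p ≠ q`; the values of `χ` on the diagonal are never used. -/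
noncomputable def monoCrossings (P : V → Plane) (χ : Sym2 V → Bool) : ℕ :=
  {c : Sym2 (Sym2 V) | ∃ p q r t : V, c = s(s(p, q), s(r, t)) ∧ p ≠ q ∧ r ≠ t ∧
    s(p, q) ≠ s(r, t) ∧ χ s(p, q) = χ s(r, t) ∧
    (openSegment ℝ (P p) (P q) ∩ openSegment ℝ (P r) (P t)).Nonempty}.ncard

/-- The number of edges of colour `c` at `p`. -/
noncomputable def colorDegree (χ : Sym2 V → Bool) (c : Bool) (p : V) : ℕ :=
  {r : V | r ≠ p ∧ χ s(p, r) = c}.ncard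

/-- The colour of the larger colour class at `p`.  (There is no tie when the number of points is
even, since then the degree of `p` is odd.) -/
noncomputable def largerColor (χ : Sym2 V → Bool) (p : V) : Bool :=
  decide (colorDegree χ false p < colorDegree χ true p)

/-- The number of edges of the larger colour class at `p` to the left of the line spanned by `p`
and `q` and directed from `q` to `p`. -/
noncomputable def largerLeft (P : V → Plane) (χ : Sym2 V → Bool) (p q : V) : ℕ :=
  {r : V | r ≠ p ∧ χ s(p, r) = largerColor χ p ∧ 0 < side (P q) (P p) (P r)}.ncard

/-- The number of edges of the larger colour class at `p` to the right of the line spanned by `p`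
and `q` and directed from `q` to `p`. -/
noncomputable def largerRight (P : V → Plane) (χ : Sym2 V → Bool) (p q : V) : ℕ :=
  {r : V | r ≠ p ∧ χ s(p, r) = largerColor χ p ∧ side (P q) (P p) (P r) < 0}.ncard

/-- `(p, q)` is a `χ`-halving edge of `p`. -/
def IsHalvingEdge (P : V → Plane) (χ : Sym2 V → Bool) (p q : V) : Prop :=
  q ≠ p ∧ largerLeft P χ p q ≤ largerRight P χ p q + 1 ∧
    largerRight P χ p q ≤ largerLeft P χ p q + 1

/-- A `χ`-halving matching: each point `p` is matched with one of its `χ`-halving edges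
`(p, M p)`, and no two points are matched with the same edge. -/
def IsHalvingMatching (P : V → Plane) (χ : Sym2 V → Bool) (M : V → V) : Prop :=
  (∀ p, IsHalvingEdge P χ p (M p)) ∧ Function.Injective fun p => s(p, M p)

end

/-- `cr̄₂(K_n)`: the least number of monochromatic crossings in a 2-edge-coloured straight-line
drawing of `K_n`. -/
noncomputable def cr2K (n : ℕ) : ℕ :=
  sInf {c : ℕ | ∃ P : Fin n → Plane, GeneralPosition P ∧
    ∃ χ : Sym2 (Fin n) → Bool, monoCrossings P χ = c}

/-- The data to which the duplication process applies: labelled points, a colour for each edge, and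
for each point `p` the other endpoint `mate p` of the edge matched with `p`. -/
structure MatchedDrawing (V : Type) where
  pos : V → Plane
  color : Sym2 V → Bool
  mate : V → V

/-- How the duplicates `p₁`, `p₂` of a point `p` with matching edge `e = (p, q)` are matched, in
the six cases.  `eLarger` says that `e` is in the larger colour class at `p`; `l` and `r` are the
numbers of edges of that class to the left and to the right of `e`; `qL` and `qR` are the
duplicates of `q` to the left and to the right of `e`; `n₁` and `n₂` are the other endpoints of
the edges matched with `p₁` and `p₂`. -/
def DuplicateMates {W : Type} (eLarger : Prop) (l r : ℕ) (p₂ qL qR n₁ n₂ : W) : Prop :=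
  (¬ eLarger → r < l → n₁ = qL ∧ n₂ = qR) ∧
  (¬ eLarger → l = r → n₁ = p₂ ∧ n₂ = qR) ∧
  (¬ eLarger → l < r → n₁ = qR ∧ n₂ = qL) ∧
  (eLarger → r < l → n₁ = qL ∧ n₂ = qL) ∧
  (eLarger → l = r → n₁ = p₂ ∧ n₂ = qL) ∧
  (eLarger → l < r → n₁ = qR ∧ n₂ = qR)

/-- `E` arises from `D` by one step of the duplication process.  The point `p` is replaced by
`p₁ = (p, 0)` and `p₂ = (p, 1)`. -/
structure IsDuplication {V : Type} (D : MatchedDrawing V) (E : MatchedDrawing (V × Fin 2)) :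
    Prop where
  /-- The duplicates of `p` lie on the line spanned by the edge matched with `p`. -/
  on_line : ∀ p i, E.pos (p, i) ∈ line[ℝ, D.pos p, D.pos (D.mate p)]
  /-- They lie on different sides of the line spanned by any other edge at `p`. -/
  opposite : ∀ p r, r ≠ p → r ≠ D.mate p →
    side (D.pos p) (D.pos r) (E.pos (p, 0)) * side (D.pos p) (D.pos r) (E.pos (p, 1)) < 0
  /-- They lie on the same side as `p` of the line spanned by any edge not incident to `p`. -/
  same_side : ∀ p q r i, p ≠ q → p ≠ r → q ≠ r →
    0 < side (D.pos q) (D.pos r) (D.pos p) * side (D.pos q) (D.pos r) (E.pos (p, i))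
  /-- `p₁` is further away from `mate p` than `p₂`. -/
  farther : ∀ p, dist (E.pos (p, 1)) (D.pos (D.mate p)) < dist (E.pos (p, 0)) (D.pos (D.mate p))
  /-- The duplicates are so near to the original points that replacing three different points by
  duplicates of them does not change the orientation of the triple. -/
  near : ∀ p q r i j k, p ≠ q → p ≠ r → q ≠ r →
    0 < side (D.pos p) (D.pos q) (D.pos r) * side (E.pos (p, i)) (E.pos (q, j)) (E.pos (r, k))
  /-- Edges between duplicates of different points inherit their colour. -/
  color_between : ∀ p q i j, p ≠ q → E.color s((p, i), (q, j)) = D.color s(p, q)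
  /-- The edge `p₁p₂` gets the colour of the larger class at `p` if the matching edge is in the
  smaller class and has different numbers of edges of the larger class on its two sides. -/
  color_pair_larger : ∀ p, D.color s(p, D.mate p) ≠ largerColor D.color p →
    largerLeft D.pos D.color p (D.mate p) ≠ largerRight D.pos D.color p (D.mate p) →
    E.color s((p, 0), (p, 1)) = largerColor D.color p
  /-- In all other cases the edge `p₁p₂` gets the colour of the smaller class at `p`. -/
  color_pair_smaller : ∀ p, (D.color s(p, D.mate p) = largerColor D.color p ∨
      largerLeft D.pos D.color p (D.mate p) = largerRight D.pos D.color p (D.mate p)) →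
    E.color s((p, 0), (p, 1)) = !largerColor D.color p
  /-- The new matching. -/
  mates : ∀ p i j,
    0 < side (D.pos (D.mate p)) (D.pos p) (E.pos (D.mate p, i)) →
    side (D.pos (D.mate p)) (D.pos p) (E.pos (D.mate p, j)) < 0 →
    DuplicateMates (D.color s(p, D.mate p) = largerColor D.color p)
      (largerLeft D.pos D.color p (D.mate p)) (largerRight D.pos D.color p (D.mate p))
      (p, 1) (D.mate p, i) (D.mate p, j) (E.mate (p, 0)) (E.mate (p, 1))

/-- The labels of the points after `k` duplication steps. -/
def DupIndex (V : Type) : ℕ → Type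
  | 0 => V
  | k + 1 => DupIndex V k × Fin 2

/-- `Q 0, Q 1, Q 2, …` are obtained from `D` by iterating the duplication process. -/
def IsDuplicationSequence {V : Type} (D : MatchedDrawing V)
    (Q : (k : ℕ) → MatchedDrawing (DupIndex V k)) : Prop :=
  Q 0 = D ∧ ∀ k, IsDuplication (Q k) (Q (k + 1))

/-!
The argument has three parts.

*Crossings.* In general position, crossing is a condition on orientations of triples
(`openSegment_inter_nonempty_iff`), so `8 * monoCrossings` counts ordered quadruples
(`orderedCrossings_eq`).  After a duplication, every orientation is determined by the old drawing:
triples with distinct originals keep their orientation, and the line through the two duplicates of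
`p` is the old matching line, which separates the two duplicates of the matched point and no other
pair of duplicates.  Quadruples of duplicates are classified by the coincidences among their
originals (`IsDuplication.sum_monoCross`).  Four different originals give 16 copies of each old
crossing.  Two duplicates of `p` together with duplicates of two other points give one
monochromatic crossing exactly when the two edges have the same colour and lie on the same side of
the line of `p`.  The duplicates of two points give one crossing unless the points are matched.
Hence the new number of crossings is 16 times the old one plus a sum of local weights and a
polynomial in the number of points (`IsDuplication.monoCrossings_eq`).

*Profiles.* The weight of `p` depends only on the numbers of edges of the two colour classes to the
left and to the right of its matching edge and on the class of that edge.  These data, the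
`Profile` of `p`, determine the profiles of both duplicates (`IsDuplication.profile_eq`).  In
particular the new matching is again halving, and the process never stops.  After one step all
profiles are stable: a matching edge that halves the larger class exactly is in the smaller class.
On stable profiles the operator that sums a function over the two duplicates has the
eigenvalues 8, 4 and 2 on the functions that matter, and the weight splits accordingly
(`Profile.weight_eq`).  So from the first step on the number `x k` of crossings satisfies
`x (k + 1) = 16 * x k + α * 8 ^ k + β * 4 ^ k + γ * 2 ^ k`, which gives the formula.

*The bound.* By averaging over subdrawings, the ratio of `cr2K n` to `n.choose 4` is at most the
corresponding ratio for any drawing with at least `n` points (`cr2K_mul_choose_le`).  Along the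
duplication sequence the latter tends to `24 * A / m ^ 4`.  Thus the bound holds even without a
cubic error term, and `f n = n ^ 3` may be taken.
-/

/-! ### Orientations and crossing segments -/

theorem side_rotate (a b c : Plane) : side b c a = side a b c := by
  unfold side; ring

theorem side_swap_left (a b c : Plane) : side b a c = -side a b c := by
  unfold side; ring

theorem side_swap_right (a b c : Plane) : side a c b = -side a b c := by
  unfold side; ring

@[simp] theorem side_self_left (a b : Plane) : side a b a = 0 := by
  unfold side; ring

@[simp] theorem side_self_right (a b : Plane) : side a b b = 0 := by
  unfold side; ring

@[simp] theorem side_self (a b : Plane) : side a a b = 0 := by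
  unfold side; ring

theorem side_lineMap (a b x y : Plane) (t : ℝ) :
    side a b (AffineMap.lineMap x y t) = (1 - t) * side a b x + t * side a b y := by
  simp only [side, AffineMap.lineMap_apply, vsub_eq_sub, vadd_eq_add, PiLp.add_apply,
    PiLp.smul_apply, PiLp.sub_apply, smul_eq_mul]
  ring

theorem side_lineMap_lineMap (a b x : Plane) (s t : ℝ) :
    side (AffineMap.lineMap a b s) (AffineMap.lineMap a b t) x = (t - s) * side a b x := by
  simp only [side, AffineMap.lineMap_apply, vsub_eq_sub, vadd_eq_add, PiLp.add_apply,
    PiLp.smul_apply, PiLp.sub_apply, smul_eq_mul]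
  ring

theorem side_eq_zero_of_collinear {a b c : Plane} (h : Collinear ℝ {a, b, c}) :
    side a b c = 0 := by
  obtain ⟨v, hv⟩ := (collinear_iff_of_mem (p₀ := a) (by simp)).1 h
  obtain ⟨s, rfl⟩ := hv b (by simp)
  obtain ⟨t, rfl⟩ := hv c (by simp)
  simp only [side, vadd_eq_add, PiLp.add_apply, PiLp.smul_apply, smul_eq_mul]
  ring

theorem collinear_of_side_eq_zero {a b c : Plane} (hab : a ≠ b) (h : side a b c = 0) :
    Collinear ℝ {a, b, c} := by
  have hne : b 0 - a 0 ≠ 0 ∨ b 1 - a 1 ≠ 0 := by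
    by_contra! hc
    apply hab
    ext i
    fin_cases i
    · exact (sub_eq_zero.1 hc.1).symm
    · exact (sub_eq_zero.1 hc.2).symm
  have key : ∀ r : ℝ, c 0 - a 0 = r * (b 0 - a 0) → c 1 - a 1 = r * (b 1 - a 1) →
      Collinear ℝ {a, b, c} := by
    intro r h0 h1
    rw [collinear_iff_of_mem (p₀ := a) (by simp)]
    refine ⟨b - a, ?_⟩
    rintro p (rfl | rfl | rfl)
    · exact ⟨0, by simp⟩
    · exact ⟨1, by simp⟩
    · refine ⟨r, ?_⟩
      ext i
      fin_cases i
      · simp; linarith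
      · simp; linarith
  unfold side at h
  rcases hne with h0 | h1
  · exact key ((c 0 - a 0) / (b 0 - a 0)) (by field_simp) (by field_simp; linarith)
  · exact key ((c 1 - a 1) / (b 1 - a 1)) (by field_simp; linarith) (by field_simp)

theorem GeneralPosition.side_ne_zero {V : Type} {P : V → Plane} (hP : GeneralPosition P)
    {p q r : V} (hpq : p ≠ q) (hpr : p ≠ r) (hqr : q ≠ r) : side (P p) (P q) (P r) ≠ 0 :=
  fun h => hP.2 p q r hpq hpr hqr (collinear_of_side_eq_zero (hP.1.ne hpq) h)

theorem side_eq_zero_of_openSegment_inter {a b d : Plane}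
    (h : (openSegment ℝ a b ∩ openSegment ℝ a d).Nonempty) : side a b d = 0 := by
  obtain ⟨x, hx, hx'⟩ := h
  rw [openSegment_eq_image_lineMap] at hx hx'
  obtain ⟨s, -, rfl⟩ := hx
  obtain ⟨t, ht, hst⟩ := hx'
  have := congrArg (side a b) hst
  simp only [side_lineMap, side_self_left, side_self_right, mul_zero, zero_add] at this
  exact (mul_eq_zero.1 this).resolve_left ht.1.ne'

theorem openSegment_inter_nonempty_iff {a b c d : Plane} (hc : side a b c ≠ 0)
    (ha : side c d a ≠ 0) :
    (openSegment ℝ a b ∩ openSegment ℝ c d).Nonempty ↔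
      side a b c * side a b d < 0 ∧ side c d a * side c d b < 0 := by
  simp only [openSegment_eq_image_lineMap]
  constructor
  · rintro ⟨x, ⟨s, ⟨hs0, hs1⟩, rfl⟩, ⟨t, ⟨ht0, ht1⟩, hst⟩⟩
    have h1 := congrArg (side a b) hst
    have h2 := congrArg (side c d) hst
    simp only [side_lineMap, side_self_left, side_self_right, mul_zero, zero_add] at h1 h2
    have aux : ∀ {x y t : ℝ}, 0 < t → t < 1 → x ≠ 0 → (1 - t) * x + t * y = 0 → x * y < 0 := by
      intro x y t h0 h1 hx h
      have : t * (x * y) = -((1 - t) * x ^ 2) := by linear_combination x * h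
      have hpos : 0 < (1 - t) * x ^ 2 := mul_pos (by linarith) (by positivity)
      by_contra! hxy
      have := mul_nonneg h0.le hxy
      linarith
    exact ⟨aux ht0 ht1 hc (by linarith), aux hs0 hs1 ha (by linarith)⟩
  · rintro ⟨h1, h2⟩
    have aux : ∀ {x y : ℝ}, x * y < 0 → x - y ≠ 0 ∧ x / (x - y) ∈ Set.Ioo (0 : ℝ) 1 := by
      intro x y h
      rcases mul_neg_iff.1 h with ⟨hx, hy⟩ | ⟨hx, hy⟩
      · have : 0 < x - y := by linarith
        exact ⟨this.ne', div_pos hx this, (div_lt_one this).2 (by linarith)⟩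
      · have : x - y < 0 := by linarith
        exact ⟨this.ne, div_pos_of_neg_of_neg hx this, (div_lt_one_of_neg this).2 (by linarith)⟩
    obtain ⟨n1, m1⟩ := aux h1
    obtain ⟨n2, m2⟩ := aux h2
    refine ⟨_, ⟨_, m2, rfl⟩, ⟨_, m1, ?_⟩⟩
    -- The two denominators are equal up to sign.
    have e : side a b c - side a b d = -(side c d a - side c d b) := by
      unfold side; ring
    rw [e] at n1 ⊢
    ext i
    fin_cases i <;>
    · simp only [AffineMap.lineMap_apply, vsub_eq_sub, vadd_eq_add, PiLp.add_apply,
        PiLp.smul_apply, PiLp.sub_apply, smul_eq_mul, Fin.zero_eta, Fin.mk_one, Fin.isValue]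
      field_simp
      unfold side
      ring

/-! ### Counting crossings by ordered quadruples; averaging over subdrawings -/

section
variable {V : Type}

/-- The edges `ab` and `cd` have the same colour and cross, in terms of orientations: each of the
two lines separates the endpoints of the other edge.  This forces the four points to be distinct. -/
def MonoCross (P : V → Plane) (χ : Sym2 V → Bool) (a b c d : V) : Prop :=
  χ s(a, b) = χ s(c, d) ∧ side (P a) (P b) (P c) * side (P a) (P b) (P d) < 0 ∧
    side (P c) (P d) (P a) * side (P c) (P d) (P b) < 0

namespace MonoCross
variable {P : V → Plane} {χ : Sym2 V → Bool} {a b c d : V}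

theorem swap_left : MonoCross P χ b a c d ↔ MonoCross P χ a b c d := by
  simp only [MonoCross, Sym2.eq_swap (a := b), side_swap_left (P b) (P a), neg_mul_neg,
    mul_comm (side (P c) (P d) (P b))]

theorem symm : MonoCross P χ c d a b ↔ MonoCross P χ a b c d := by
  simp only [MonoCross, eq_comm (a := χ s(c, d))]
  tauto

theorem swap_right : MonoCross P χ a b d c ↔ MonoCross P χ a b c d := by
  rw [← symm, swap_left, symm]

theorem left_ne (h : MonoCross P χ a b c d) : a ≠ b := by
  rintro rfl
  simp [MonoCross] at h

theorem ne (h : MonoCross P χ a b c d) : a ≠ c := by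
  rintro rfl
  simp [MonoCross] at h

theorem pairwise_ne (h : MonoCross P χ a b c d) :
    a ≠ b ∧ a ≠ c ∧ a ≠ d ∧ b ≠ c ∧ b ≠ d ∧ c ≠ d :=
  ⟨h.left_ne, h.ne, (swap_right.2 h).ne, (swap_left.2 h).ne, (swap_left.2 (swap_right.2 h)).ne,
    (symm.2 h).left_ne⟩

theorem iff_openSegment (hP : GeneralPosition P) :
    MonoCross P χ a b c d ↔ a ≠ b ∧ c ≠ d ∧ s(a, b) ≠ s(c, d) ∧ χ s(a, b) = χ s(c, d) ∧
      (openSegment ℝ (P a) (P b) ∩ openSegment ℝ (P c) (P d)).Nonempty := by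
  constructor
  · intro h
    obtain ⟨hab, hac, had, hbc, hbd, hcd⟩ := h.pairwise_ne
    refine ⟨hab, hcd, by simp [hac, had], h.1, ?_⟩
    exact (openSegment_inter_nonempty_iff (hP.side_ne_zero hab hac hbc)
      (hP.side_ne_zero hcd hac.symm had.symm)).2 h.2
  · rintro ⟨hab, hcd, hne, hχ, h⟩
    -- Edges with a common endpoint do not cross.
    have aux : ∀ {a b d : V}, a ≠ b → a ≠ d → s(a, b) ≠ s(a, d) →
        ¬(openSegment ℝ (P a) (P b) ∩ openSegment ℝ (P a) (P d)).Nonempty := by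
      intro a b d hab had hne h
      have hbd : b ≠ d := by rintro rfl; exact hne rfl
      exact hP.side_ne_zero hab had hbd (side_eq_zero_of_openSegment_inter h)
    have hac : a ≠ c := by
      rintro rfl
      exact aux hab hcd hne h
    have had : a ≠ d := by
      rintro rfl
      rw [openSegment_symm ℝ (P c)] at h
      exact aux hab hcd.symm (by rwa [Sym2.eq_swap (a := a) (b := c)]) h
    have hbc : b ≠ c := by
      rintro rfl
      rw [openSegment_symm ℝ (P a)] at h
      exact aux hab.symm hcd (by rwa [Sym2.eq_swap (a := b) (b := a)]) h
    exact ⟨hχ, (openSegment_inter_nonempty_iff (hP.side_ne_zero hab hac hbc)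
      (hP.side_ne_zero hcd hac.symm had.symm)).1 h⟩

theorem comp_iff {W : Type} (g : W → V) {a b c d : W} :
    MonoCross (P ∘ g) (χ ∘ Sym2.map g) a b c d ↔ MonoCross P χ (g a) (g b) (g c) (g d) := by
  simp [MonoCross]

end MonoCross

open scoped Classical in
/-- The number of ordered quadruples `(a, b, c, d)` such that `ab` and `cd` are crossing edges of
the same colour. -/
noncomputable def orderedCrossings [Fintype V] (P : V → Plane) (χ : Sym2 V → Bool) : ℕ :=
  ∑ a, ∑ b, ∑ c, ∑ d, if MonoCross P χ a b c d then 1 else 0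

open scoped Classical in
/-- Every crossing pair of edges arises from eight ordered quadruples. -/
theorem orderedCrossings_eq [Fintype V] {P : V → Plane} (hP : GeneralPosition P)
    (χ : Sym2 V → Bool) : orderedCrossings P χ = 8 * monoCrossings P χ := by
  let T : Finset (V × V × V × V) :=
    Finset.univ.filter fun x => MonoCross P χ x.1 x.2.1 x.2.2.1 x.2.2.2
  let S : Finset (Sym2 (Sym2 V)) := Finset.univ.filter fun c => ∃ p q r t : V,
    c = s(s(p, q), s(r, t)) ∧ p ≠ q ∧ r ≠ t ∧ s(p, q) ≠ s(r, t) ∧ χ s(p, q) = χ s(r, t) ∧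
      (openSegment ℝ (P p) (P q) ∩ openSegment ℝ (P r) (P t)).Nonempty
  let f : V × V × V × V → Sym2 (Sym2 V) := fun x => s(s(x.1, x.2.1), s(x.2.2.1, x.2.2.2))
  have hT : orderedCrossings P χ = T.card := by
    simp only [orderedCrossings, T, Finset.card_filter, Fintype.sum_prod_type]
  have hS : monoCrossings P χ = S.card := by
    rw [monoCrossings, Set.ncard_eq_toFinset_card']
    congr 1
    ext c
    simp [S]
  have hmaps : ∀ x ∈ T, f x ∈ S := by
    rintro ⟨a, b, c, d⟩ h
    simp only [T, Finset.mem_filter, Finset.mem_univ, true_and] at h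
    simp only [S, Finset.mem_filter, Finset.mem_univ, true_and]
    exact ⟨a, b, c, d, rfl, (MonoCross.iff_openSegment hP).1 h⟩
  have hfib : ∀ y ∈ S, (T.filter fun x => f x = y).card = 8 := by
    intro y hy
    simp only [S, Finset.mem_filter, Finset.mem_univ, true_and] at hy
    obtain ⟨a, b, c, d, rfl, h⟩ := hy
    have h := (MonoCross.iff_openSegment hP).2 h
    obtain ⟨hab, hac, had, hbc, hbd, hcd⟩ := h.pairwise_ne
    have : (T.filter fun x => f x = s(s(a, b), s(c, d))) =
        {(a, b, c, d), (b, a, c, d), (a, b, d, c), (b, a, d, c),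
          (c, d, a, b), (c, d, b, a), (d, c, a, b), (d, c, b, a)} := by
      ext ⟨p, q, r, t⟩
      simp only [T, f, Finset.mem_filter, Finset.mem_univ, true_and, Finset.mem_insert,
        Finset.mem_singleton, Prod.mk.injEq, Sym2.eq_iff]
      constructor
      · rintro ⟨-, (⟨⟨rfl, rfl⟩ | ⟨rfl, rfl⟩, ⟨rfl, rfl⟩ | ⟨rfl, rfl⟩⟩ |
          ⟨⟨rfl, rfl⟩ | ⟨rfl, rfl⟩, ⟨rfl, rfl⟩ | ⟨rfl, rfl⟩⟩)⟩ <;> simp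
      · have h1 := MonoCross.swap_left.2 h
        have h2 := MonoCross.swap_right.2 h
        have h3 := MonoCross.swap_right.2 h1
        rintro (⟨rfl, rfl, rfl, rfl⟩ | ⟨rfl, rfl, rfl, rfl⟩ | ⟨rfl, rfl, rfl, rfl⟩ |
          ⟨rfl, rfl, rfl, rfl⟩ | ⟨rfl, rfl, rfl, rfl⟩ | ⟨rfl, rfl, rfl, rfl⟩ |
          ⟨rfl, rfl, rfl, rfl⟩ | ⟨rfl, rfl, rfl, rfl⟩)
        · exact ⟨h, by simp⟩
        · exact ⟨h1, by simp⟩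
        · exact ⟨h2, by simp⟩
        · exact ⟨h3, by simp⟩
        · exact ⟨MonoCross.symm.2 h, by simp⟩
        · exact ⟨MonoCross.symm.2 h1, by simp⟩
        · exact ⟨MonoCross.symm.2 h2, by simp⟩
        · exact ⟨MonoCross.symm.2 h3, by simp⟩
    rw [this]
    repeat rw [Finset.card_insert_of_notMem]
    · simp
    all_goals simp [hab, hac, had, hbc, hbd, hcd, hab.symm, hac.symm, had.symm, hbc.symm,
      hbd.symm, hcd.symm]
  rw [hT, hS, Finset.card_eq_sum_card_fiberwise hmaps, Finset.sum_congr rfl hfib]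
  simp [mul_comm]

theorem GeneralPosition.comp {W : Type} {P : V → Plane} (hP : GeneralPosition P) {g : W → V}
    (hg : Function.Injective g) : GeneralPosition (P ∘ g) :=
  ⟨hP.1.comp hg, fun p q r hpq hpr hqr =>
    hP.2 (g p) (g q) (g r) (hg.ne hpq) (hg.ne hpr) (hg.ne hqr)⟩

open scoped Classical in
theorem monoCrossings_comp_equiv [Fintype V] {W : Type} [Fintype W] {P : V → Plane}
    (hP : GeneralPosition P) (χ : Sym2 V → Bool) (e : W ≃ V) :
    monoCrossings (P ∘ e) (χ ∘ Sym2.map e) = monoCrossings P χ := by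
  have h : orderedCrossings (P ∘ e) (χ ∘ Sym2.map e) = orderedCrossings P χ := by
    simp only [orderedCrossings]
    rw [← Equiv.sum_comp e]
    refine Finset.sum_congr rfl fun a _ => ?_
    rw [← Equiv.sum_comp e]
    refine Finset.sum_congr rfl fun b _ => ?_
    rw [← Equiv.sum_comp e]
    refine Finset.sum_congr rfl fun c _ => ?_
    rw [← Equiv.sum_comp e]
    exact Finset.sum_congr rfl fun d _ => if_congr (MonoCross.comp_iff e) rfl rfl
  rw [orderedCrossings_eq (hP.comp e.injective), orderedCrossings_eq hP] at h
  omega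

open scoped Classical in
/-- Deleting each vertex in turn, every crossing survives all but four of the deletions. -/
theorem sum_monoCrossings_succAbove {N : ℕ} {P : Fin (N + 1) → Plane} (hP : GeneralPosition P)
    (χ : Sym2 (Fin (N + 1)) → Bool) :
    (∑ v : Fin (N + 1), monoCrossings (P ∘ v.succAbove) (χ ∘ Sym2.map v.succAbove)) +
      4 * monoCrossings P χ = (N + 1) * monoCrossings P χ := by
  have hdel : ∀ (v : Fin (N + 1)) (f : Fin (N + 1) → ℕ),
      ∑ a, f (v.succAbove a) = ∑ a, if a ≠ v then f a else 0 := by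
    intro v f
    rw [Fin.sum_univ_succAbove _ v]
    simp [Fin.succAbove_ne]
  have h : (∑ v : Fin (N + 1), orderedCrossings (P ∘ v.succAbove) (χ ∘ Sym2.map v.succAbove)) +
      4 * orderedCrossings P χ = (N + 1) * orderedCrossings P χ := by
    have hv : ∀ v : Fin (N + 1),
        orderedCrossings (P ∘ v.succAbove) (χ ∘ Sym2.map v.succAbove) =
          ∑ a, ∑ b, ∑ c, ∑ d,
            if MonoCross P χ a b c d ∧ a ≠ v ∧ b ≠ v ∧ c ≠ v ∧ d ≠ v then 1 else 0 := by
      intro v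
      simp only [orderedCrossings, MonoCross.comp_iff]
      rw [hdel v fun a => ∑ b, ∑ c, ∑ d, if MonoCross P χ a (v.succAbove b) (v.succAbove c)
        (v.succAbove d) then 1 else 0]
      refine Finset.sum_congr rfl fun a _ => ?_
      by_cases ha : a = v
      · simp [ha]
      simp only [ne_eq, ha, not_false_eq_true, if_true, true_and]
      rw [hdel v fun b => ∑ c, ∑ d, if MonoCross P χ a b (v.succAbove c)
        (v.succAbove d) then 1 else 0]
      refine Finset.sum_congr rfl fun b _ => ?_
      by_cases hb : b = v
      · simp [hb]
      simp only [ne_eq, hb, not_false_eq_true, if_true, true_and]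
      rw [hdel v fun c => ∑ d, if MonoCross P χ a b c (v.succAbove d) then 1 else 0]
      refine Finset.sum_congr rfl fun c _ => ?_
      by_cases hc : c = v
      · simp [hc]
      simp only [ne_eq, hc, not_false_eq_true, if_true, true_and]
      rw [hdel v fun d => if MonoCross P χ a b c d then 1 else 0]
      refine Finset.sum_congr rfl fun d _ => ?_
      by_cases hd : d = v <;> simp [hd]
    simp only [hv]
    unfold orderedCrossings
    rw [Finset.sum_comm, Finset.mul_sum, Finset.mul_sum, ← Finset.sum_add_distrib]
    refine Finset.sum_congr rfl fun a _ => ?_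
    rw [Finset.sum_comm, Finset.mul_sum, Finset.mul_sum, ← Finset.sum_add_distrib]
    refine Finset.sum_congr rfl fun b _ => ?_
    rw [Finset.sum_comm, Finset.mul_sum, Finset.mul_sum, ← Finset.sum_add_distrib]
    refine Finset.sum_congr rfl fun c _ => ?_
    rw [Finset.sum_comm, Finset.mul_sum, Finset.mul_sum, ← Finset.sum_add_distrib]
    refine Finset.sum_congr rfl fun d _ => ?_
    by_cases hx : MonoCross P χ a b c d
    · obtain ⟨hab, hac, had, hbc, hbd, hcd⟩ := hx.pairwise_ne
      have h4 : ({a, b, c, d} : Finset (Fin (N + 1))).card = 4 := by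
        repeat rw [Finset.card_insert_of_notMem]
        · simp
        all_goals simp [hab, hac, had, hbc, hbd, hcd]
      have hc := Finset.card_compl_add_card ({a, b, c, d} : Finset (Fin (N + 1)))
      rw [h4, Fintype.card_fin] at hc
      simp only [hx, true_and, if_true, mul_one]
      rw [← Finset.card_filter]
      refine Eq.trans ?_ hc
      congr 2
      ext v
      simp [eq_comm (a := v)]
    · simp [hx]
  rw [orderedCrossings_eq hP, Finset.sum_congr rfl fun v _ =>
    orderedCrossings_eq (hP.comp v.succAbove_right_injective) _, ← Finset.mul_sum] at h
  linarith

theorem cr2K_le {n : ℕ} {P : Fin n → Plane} (hP : GeneralPosition P) (χ : Sym2 (Fin n) → Bool) :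
    cr2K n ≤ monoCrossings P χ :=
  Nat.sInf_le ⟨P, hP, χ, rfl⟩

/-- The density of crossings in a drawing is at least the density in an optimal drawing with fewer
points, by averaging over the subdrawings. -/
theorem cr2K_mul_choose_le {n : ℕ} (hn : 4 ≤ n) {N : ℕ} (hnN : n ≤ N) :
    ∀ {P : Fin N → Plane}, GeneralPosition P → ∀ χ : Sym2 (Fin N) → Bool,
      cr2K n * N.choose 4 ≤ monoCrossings P χ * n.choose 4 := by
  induction N, hnN using Nat.le_induction with
  | base => intro P hP χ; exact Nat.mul_le_mul_right _ (cr2K_le hP χ)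
  | succ N hnN ih =>
    intro P hP χ
    have h1 := Finset.sum_le_sum fun v (_ : v ∈ (Finset.univ : Finset (Fin (N + 1)))) =>
      ih (hP.comp v.succAbove_right_injective) (χ ∘ Sym2.map v.succAbove)
    simp only [Finset.sum_const, Finset.card_univ, Fintype.card_fin, smul_eq_mul] at h1
    rw [← Finset.sum_mul] at h1
    have h2 := sum_monoCrossings_succAbove hP χ
    have h3 : N.choose 4 * (N + 1) = (N + 1).choose 4 * (N + 1 - 4) :=
      Nat.choose_mul_succ_eq N 4
    obtain ⟨M, rfl⟩ : ∃ M, N = M + 3 := ⟨N - 3, by omega⟩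
    have h4 : M + 3 + 1 - 4 = M := by omega
    rw [h4] at h3
    have hM : 0 < M := by omega
    refine Nat.le_of_mul_le_mul_left ?_ hM
    set s := ∑ v : Fin (M + 3 + 1), monoCrossings (P ∘ v.succAbove) (χ ∘ Sym2.map v.succAbove)
    have h5 : s = M * monoCrossings P χ := by linarith
    rw [h5] at h1
    calc M * (cr2K n * (M + 3 + 1).choose 4)
        = cr2K n * ((M + 3 + 1).choose 4 * M) := by ring
      _ = (M + 3 + 1) * (cr2K n * (M + 3).choose 4) := by rw [← h3]; ring
      _ ≤ _ := h1
      _ = _ := by ring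

theorem cr2K_eq_zero {n : ℕ} (hn : n < 4) : cr2K n = 0 := by
  classical
  rcases Set.eq_empty_or_nonempty {c : ℕ | ∃ P : Fin n → Plane, GeneralPosition P ∧
    ∃ χ : Sym2 (Fin n) → Bool, monoCrossings P χ = c} with h | ⟨_, P, hP, χ, -⟩
  · rw [cr2K, h, Nat.sInf_empty]
  · refine Nat.eq_zero_of_le_zero ((cr2K_le hP χ).trans ?_)
    have h8 := orderedCrossings_eq hP χ
    suffices orderedCrossings P χ = 0 by omega
    simp only [orderedCrossings, Finset.sum_eq_zero_iff, Finset.mem_univ, true_imp_iff]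
    intro a b c d
    refine if_neg fun h => ?_
    obtain ⟨hab, hac, had, hbc, hbd, hcd⟩ := h.pairwise_ne
    omega

end

/-! ### The geometry of a duplication step -/

section
variable {V : Type}

theorem mul_pos_of_mul_pos_left {s x y : ℝ} (hx : 0 < s * x) (hy : 0 < s * y) : 0 < x * y := by
  have h : 0 < s ^ 2 * (x * y) := by
    have := mul_pos hx hy
    linarith [show s * x * (s * y) = s ^ 2 * (x * y) by ring]
  exact pos_of_mul_pos_right h (sq_nonneg s)

/-- The configurations to which the duplication process applies. -/
structure IsHalvingDrawing (D : MatchedDrawing V) : Prop where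
  generalPosition : GeneralPosition D.pos
  matching : IsHalvingMatching D.pos D.color D.mate

namespace IsHalvingDrawing
variable {D : MatchedDrawing V}

theorem mate_ne (hD : IsHalvingDrawing D) (p : V) : D.mate p ≠ p :=
  (hD.matching.1 p).1

theorem mate_mate_ne (hD : IsHalvingDrawing D) (p : V) : D.mate (D.mate p) ≠ p := by
  intro h
  have : p = D.mate p := hD.matching.2 (by
    change s(p, D.mate p) = s(D.mate p, D.mate (D.mate p))
    rw [h, Sym2.eq_swap])
  exact hD.mate_ne p this.symm

end IsHalvingDrawing

namespace IsDuplication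
variable {D : MatchedDrawing V} {E : MatchedDrawing (V × Fin 2)}

/-- The duplicates of `p` lie on the two sides of `p` on the line of its matching edge, and before
the other endpoint of that edge. -/
theorem exists_param (hE : IsDuplication D E) (hD : IsHalvingDrawing D) :
    ∃ t : V → Fin 2 → ℝ,
      (∀ p i, E.pos (p, i) = AffineMap.lineMap (D.pos p) (D.pos (D.mate p)) (t p i)) ∧
      ∀ p, t p 0 < 0 ∧ 0 < t p 1 := by
  have hline := hE.on_line
  simp only [mem_affineSpan_pair_iff_exists_lineMap_eq] at hline
  choose t ht using hline
  refine ⟨t, fun p i => (ht p i).symm, fun p => ?_⟩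
  have hpr : p ≠ D.mate (D.mate p) := (hD.mate_mate_ne p).symm
  have hqr : D.mate p ≠ D.mate (D.mate p) := (hD.mate_ne _).symm
  have hpq : p ≠ D.mate p := (hD.mate_ne p).symm
  have hs := hD.generalPosition.side_ne_zero hpr hpq hqr.symm
  have hs' := hD.generalPosition.side_ne_zero hqr hpq.symm hpr.symm
  have hopp := hE.opposite p _ hpr.symm hqr.symm
  have hlt : ∀ i, t p i < 1 := by
    intro i
    have h := hE.same_side p _ _ i hpq hpr hqr
    rw [← ht, side_lineMap, side_self_left] at h
    by_contra! h1
    have := mul_nonneg (sub_nonneg.2 h1) (sq_nonneg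
      (side (D.pos (D.mate p)) (D.pos (D.mate (D.mate p))) (D.pos p)))
    linarith
  have hfar := hE.farther p
  rw [← ht, ← ht, dist_lineMap_right, dist_lineMap_right, Real.norm_eq_abs, Real.norm_eq_abs,
    abs_of_pos (sub_pos.2 (hlt 0)), abs_of_pos (sub_pos.2 (hlt 1))] at hfar
  have h01 : t p 0 < t p 1 := by
    have := lt_of_mul_lt_mul_right hfar dist_nonneg
    linarith
  rw [← ht, ← ht, side_lineMap, side_lineMap, side_self_left] at hopp
  have hneg : t p 0 * t p 1 < 0 := by
    by_contra! h1
    have := mul_nonneg h1 (sq_nonneg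
      (side (D.pos p) (D.pos (D.mate (D.mate p))) (D.pos (D.mate p))))
    linarith
  rcases mul_neg_iff.1 hneg with h | h
  · linarith
  · exact h

/-- The line through the duplicates of `p` is the line of the matching edge, directed from `p`
towards its other endpoint. -/
theorem exists_side_pair_eq (hE : IsDuplication D E) (hD : IsHalvingDrawing D) (p : V) :
    ∃ c : ℝ, 0 < c ∧ ∀ x, side (E.pos (p, 0)) (E.pos (p, 1)) x =
      c * side (D.pos p) (D.pos (D.mate p)) x := by
  obtain ⟨t, ht, h01⟩ := hE.exists_param hD
  refine ⟨t p 1 - t p 0, by linarith [(h01 p).1, (h01 p).2], fun x => ?_⟩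
  rw [ht, ht, side_lineMap_lineMap]

theorem side_pair_pos (hE : IsDuplication D E) (hD : IsHalvingDrawing D) {p r : V} (hr : r ≠ p)
    (hr' : r ≠ D.mate p) (k : Fin 2) :
    0 < side (D.pos p) (D.pos (D.mate p)) (D.pos r) *
      side (E.pos (p, 0)) (E.pos (p, 1)) (E.pos (r, k)) := by
  obtain ⟨c, hc, h⟩ := hE.exists_side_pair_eq hD p
  rw [h, mul_left_comm]
  exact mul_pos hc (hE.same_side r p (D.mate p) k hr hr' (hD.mate_ne p).symm)

/-- The duplicates of the point matched with `p` lie on different sides of the matching edge. -/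
theorem side_mate_neg (hE : IsDuplication D E) (hD : IsHalvingDrawing D) (p : V) :
    side (D.pos (D.mate p)) (D.pos p) (E.pos (D.mate p, 0)) *
      side (D.pos (D.mate p)) (D.pos p) (E.pos (D.mate p, 1)) < 0 :=
  hE.opposite (D.mate p) p (hD.mate_ne p).symm (hD.mate_mate_ne p).symm

theorem side_pair_mate (hE : IsDuplication D E) (hD : IsHalvingDrawing D) (p : V) (k : Fin 2)
    (h : side (D.pos (D.mate p)) (D.pos p) (E.pos (D.mate p, k)) ≠ 0) :
    side (D.pos (D.mate p)) (D.pos p) (E.pos (D.mate p, k)) *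
      side (E.pos (p, 0)) (E.pos (p, 1)) (E.pos (D.mate p, k)) < 0 := by
  obtain ⟨c, hc, hx⟩ := hE.exists_side_pair_eq hD p
  rw [hx, side_swap_left (D.pos (D.mate p)) (D.pos p)]
  have : 0 < c * side (D.pos (D.mate p)) (D.pos p) (E.pos (D.mate p, k)) ^ 2 := by positivity
  linarith

theorem side_pair_mate_neg (hE : IsDuplication D E) (hD : IsHalvingDrawing D) (p : V) :
    side (E.pos (p, 0)) (E.pos (p, 1)) (E.pos (D.mate p, 0)) *
      side (E.pos (p, 0)) (E.pos (p, 1)) (E.pos (D.mate p, 1)) < 0 := by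
  obtain ⟨c, hc, hx⟩ := hE.exists_side_pair_eq hD p
  have h := hE.side_mate_neg hD p
  rw [hx, hx, side_swap_left (D.pos (D.mate p)) (D.pos p),
    side_swap_left (D.pos (D.mate p)) (D.pos p)]
  have := mul_neg_of_pos_of_neg (mul_pos hc hc) h
  linarith

theorem side_pair_ne_zero (hE : IsDuplication D E) (hD : IsHalvingDrawing D) {p r : V} (hr : r ≠ p)
    (k : Fin 2) : side (E.pos (p, 0)) (E.pos (p, 1)) (E.pos (r, k)) ≠ 0 := by
  by_cases hr' : r = D.mate p
  · subst hr'
    have h := (hE.side_pair_mate_neg hD p).ne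
    fin_cases k
    · exact left_ne_zero_of_mul h
    · exact right_ne_zero_of_mul h
  · exact right_ne_zero_of_mul (hE.side_pair_pos hD hr hr' k).ne'

theorem side_ne_zero (hE : IsDuplication D E) (hD : IsHalvingDrawing D) {a b c : V × Fin 2}
    (hab : a ≠ b) (hac : a ≠ c) (hbc : b ≠ c) : side (E.pos a) (E.pos b) (E.pos c) ≠ 0 := by
  have aux : ∀ {p r : V} {i j k : Fin 2}, (p, i) ≠ (p, j) → (p, i) ≠ (r, k) → (p, j) ≠ (r, k) →
      side (E.pos (p, i)) (E.pos (p, j)) (E.pos (r, k)) ≠ 0 := by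
    intro p r i j k hij hik hjk
    have hr : r ≠ p := by
      rintro rfl
      simp only [ne_eq, Prod.mk.injEq, true_and] at hij hik hjk
      omega
    fin_cases i <;> fin_cases j
    · exact absurd rfl hij
    · exact hE.side_pair_ne_zero hD hr k
    · rw [side_swap_left]
      exact neg_ne_zero.2 (hE.side_pair_ne_zero hD hr k)
    · exact absurd rfl hij
  obtain ⟨p, i⟩ := a
  obtain ⟨q, j⟩ := b
  obtain ⟨r, k⟩ := c
  by_cases hpq : p = q
  · subst hpq
    exact aux hab hac hbc
  by_cases hpr : p = r
  · subst hpr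
    rw [side_swap_right]
    exact neg_ne_zero.2 (aux hac hab hbc.symm)
  by_cases hqr : q = r
  · subst hqr
    rw [← side_rotate]
    exact aux hbc hab.symm hac.symm
  · exact right_ne_zero_of_mul (hE.near p q r i j k hpq hpr hqr).ne'

theorem generalPosition (hE : IsDuplication D E) (hD : IsHalvingDrawing D) :
    GeneralPosition E.pos := by
  refine ⟨fun a b h => ?_, fun a b c hab hac hbc h =>
    hE.side_ne_zero hD hab hac hbc (side_eq_zero_of_collinear h)⟩
  by_contra hab
  obtain ⟨c, hac, hbc⟩ : ∃ c, a ≠ c ∧ b ≠ c := by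
    have h1 := hD.mate_ne a.1
    have h2 := hD.mate_mate_ne a.1
    have h3 := hD.mate_ne (D.mate a.1)
    by_cases hb : b.1 = D.mate a.1
    · exact ⟨(D.mate (D.mate a.1), 0), fun h => h2 (congrArg Prod.fst h).symm,
        fun h => h3 ((congrArg Prod.fst h).symm.trans hb)⟩
    · exact ⟨(D.mate a.1, 0), fun h => h1 (congrArg Prod.fst h).symm,
        fun h => hb (congrArg Prod.fst h)⟩
  exact hE.side_ne_zero hD hab hac hbc (by rw [h, side_self])

/-- The short edge between the two duplicates of a point crosses no other edge. -/
theorem not_monoCross_pair (hE : IsDuplication D E) (hD : IsHalvingDrawing D) (p : V) (i j : Fin 2)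
    (c d : V × Fin 2) : ¬ MonoCross E.pos E.color (p, i) (p, j) c d := by
  have key : ∀ c d, ¬ MonoCross E.pos E.color (p, 0) (p, 1) c d := by
    rintro ⟨q, k⟩ ⟨r, l⟩ h
    have hp : ∀ {q : V} {k : Fin 2}, (p, (0 : Fin 2)) ≠ (q, k) → (p, (1 : Fin 2)) ≠ (q, k) →
        q ≠ p := by
      rintro q k h0 h1 rfl
      simp only [ne_eq, Prod.mk.injEq, true_and] at h0 h1
      omega
    obtain ⟨-, h0c, h0d, h1c, h1d, hcd⟩ := h.pairwise_ne
    have hq := hp h0c h1c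
    have hr := hp h0d h1d
    by_cases hqr : q = r
    · subst hqr
      have key2 : ¬ MonoCross E.pos E.color (p, 0) (p, 1) (q, 0) (q, 1) := by
        intro h
        by_cases hpq : p = D.mate q
        · have hqp : q ≠ D.mate p := by
            rintro h'
            exact hD.mate_mate_ne q (by rw [← hpq, ← h'])
          have := mul_pos_of_mul_pos_left (hE.side_pair_pos hD hq hqp 0)
            (hE.side_pair_pos hD hq hqp 1)
          exact this.not_gt h.2.1
        · have := mul_pos_of_mul_pos_left (hE.side_pair_pos hD hq.symm hpq 0)
            (hE.side_pair_pos hD hq.symm hpq 1)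
          exact this.not_gt h.2.2
      fin_cases k <;> fin_cases l
      · exact hcd rfl
      · exact key2 h
      · exact key2 (MonoCross.swap_right.2 h)
      · exact hcd rfl
    · have := mul_pos_of_mul_pos_left (hE.near q r p k l 0 hqr hq hr)
        (hE.near q r p k l 1 hqr hq hr)
      exact this.not_gt h.2.2
  intro h
  have hij := h.left_ne
  fin_cases i <;> fin_cases j
  · exact hij rfl
  · exact key c d h
  · exact key c d (MonoCross.swap_left.2 h)
  · exact hij rfl

end IsDuplication

open scoped Classical in
/-- If the line `bd` does not separate `a` and `a'`, then exactly one of the two pairs of edges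
joining `{a, a'}` to `{b, d}` crosses when the line `aa'` does not separate `b` and `d`, and none
does when it separates them. -/
theorem monoCross_add_monoCross {W : Type} {P : W → Plane} {χ : Sym2 W → Bool} {a a' b d : W}
    (hb : χ s(a, b) = χ s(a', b)) (hd : χ s(a, d) = χ s(a', d))
    (h : 0 < side (P b) (P d) (P a) * side (P b) (P d) (P a'))
    (hx : side (P a) (P a') (P b) ≠ 0) (hy : side (P a) (P a') (P d) ≠ 0) :
    ((if MonoCross P χ a b a' d then 1 else 0) + if MonoCross P χ a d a' b then 1 else 0) =
      if χ s(a, b) = χ s(a, d) ∧ 0 < side (P a) (P a') (P b) * side (P a) (P a') (P d)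
        then 1 else 0 := by
  have e1 : side (P a) (P b) (P a') = -side (P a) (P a') (P b) := by unfold side; ring
  have e2 : side (P a) (P b) (P d) = side (P b) (P d) (P a) := by unfold side; ring
  have e3 : side (P a') (P d) (P a) = side (P a) (P a') (P d) := by unfold side; ring
  have e4 : side (P a') (P d) (P b) = -side (P b) (P d) (P a') := by unfold side; ring
  have e5 : side (P a) (P d) (P a') = -side (P a) (P a') (P d) := by unfold side; ring
  have e6 : side (P a) (P d) (P b) = -side (P b) (P d) (P a) := by unfold side; ring
  have e7 : side (P a') (P b) (P a) = side (P a) (P a') (P b) := by unfold side; ring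
  have e8 : side (P a') (P b) (P d) = side (P b) (P d) (P a') := by unfold side; ring
  have hcol : (χ s(a, d) = χ s(a, b)) = (χ s(a, b) = χ s(a, d)) := propext eq_comm
  simp only [MonoCross, ← hb, ← hd, e1, e2, e3, e4, e5, e6, e7, e8, hcol]
  generalize side (P a) (P a') (P b) = x at *
  generalize side (P a) (P a') (P d) = y at *
  generalize side (P b) (P d) (P a) = z at *
  generalize side (P b) (P d) (P a') = w at *
  by_cases hχ : χ s(a, b) = χ s(a, d)
  · simp only [hχ, true_and]
    rcases pos_and_pos_or_neg_and_neg_of_mul_pos h with ⟨hz, hw⟩ | ⟨hz, hw⟩ <;>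
    rcases hx.lt_or_gt with hx | hx <;> rcases hy.lt_or_gt with hy | hy <;>
    simp [mul_pos_iff, mul_neg_iff, hz, hw, hx, hy, hz.not_gt,
      hw.not_gt, hx.not_gt, hy.not_gt]
  · simp [hχ]

end

/-! ### Crossings after a duplication step -/

section
variable {V : Type}

theorem mul_pos_iff_of_mul_pos {s t x y : ℝ} (hx : 0 < s * x) (hy : 0 < t * y) :
    0 < x * y ↔ 0 < s * t := by
  have h : 0 < (s * t) * (x * y) := by
    have := mul_pos hx hy
    linarith [show s * x * (t * y) = (s * t) * (x * y) by ring]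
  exact ⟨fun h' => pos_of_mul_pos_left h h'.le, fun h' => pos_of_mul_pos_right h h'.le⟩

theorem ite_pos_add_ite_pos {u v y : ℝ} (h : u * v < 0) (hy : y ≠ 0) :
    ((if 0 < u * y then 1 else 0) + if 0 < v * y then 1 else 0) = 1 := by
  rcases mul_neg_iff.1 h with ⟨hu, hv⟩ | ⟨hu, hv⟩ <;> rcases hy.lt_or_gt with hy | hy <;>
  simp [mul_pos_iff, hu, hv, hy, hu.not_gt, hv.not_gt, hy.not_gt]

open scoped Classical in
/-- The number of monochromatic crossings between an edge from a duplicate of `p` to a duplicate of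
`q` and an edge from the other duplicate of `p` to a duplicate of `t`. -/
noncomputable def pathWeight (D : MatchedDrawing V) (p q t : V) : ℕ :=
  if p ≠ q ∧ p ≠ t ∧ q ≠ t ∧ D.color s(p, q) = D.color s(p, t) then
    if q = D.mate p ∨ t = D.mate p then 2
    else if 0 < side (D.pos p) (D.pos (D.mate p)) (D.pos q) *
      side (D.pos p) (D.pos (D.mate p)) (D.pos t) then 4 else 0
  else 0

open scoped Classical in
/-- Twice the number of monochromatic crossings among the duplicates of `p` and `q`. -/
noncomputable def pairWeight (D : MatchedDrawing V) (p q : V) : ℕ :=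
  if p ≠ q ∧ q ≠ D.mate p ∧ p ≠ D.mate q then 2 else 0

namespace IsDuplication
variable {D : MatchedDrawing V} {E : MatchedDrawing (V × Fin 2)}

open scoped Classical in
theorem sum_monoCross_path (hE : IsDuplication D E) (hD : IsHalvingDrawing D) {p q t : V}
    (hpq : p ≠ q) (hpt : p ≠ t) (hqt : q ≠ t) :
    (∑ i, ∑ j, ∑ k, ∑ l, if MonoCross E.pos E.color (p, i) (q, j) (p, k) (t, l) then 1 else 0) =
      pathWeight D p q t := by
  have h0 : ∀ i j l, ¬ MonoCross E.pos E.color (p, i) (q, j) (p, i) (t, l) :=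
    fun i j l h => h.ne rfl
  have h1 : ∀ j l, ((if MonoCross E.pos E.color (p, 0) (q, j) (p, 1) (t, l) then 1 else 0) +
      if MonoCross E.pos E.color (p, 1) (q, j) (p, 0) (t, l) then 1 else 0) =
      if D.color s(p, q) = D.color s(p, t) ∧
        0 < side (E.pos (p, 0)) (E.pos (p, 1)) (E.pos (q, j)) *
          side (E.pos (p, 0)) (E.pos (p, 1)) (E.pos (t, l)) then 1 else 0 := by
    intro j l
    have h := monoCross_add_monoCross (P := E.pos) (χ := E.color) (a := (p, 0)) (a' := (p, 1))
      (b := (q, j)) (d := (t, l))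
      (by rw [hE.color_between _ _ _ _ hpq, hE.color_between _ _ _ _ hpq])
      (by rw [hE.color_between _ _ _ _ hpt, hE.color_between _ _ _ _ hpt])
      (mul_pos_of_mul_pos_left (hE.near q t p j l 0 hqt hpq.symm hpt.symm)
        (hE.near q t p j l 1 hqt hpq.symm hpt.symm))
      (hE.side_pair_ne_zero hD hpq.symm j) (hE.side_pair_ne_zero hD hpt.symm l)
    rw [hE.color_between _ _ _ _ hpq, hE.color_between _ _ _ _ hpt] at h
    rw [← h, MonoCross.symm (a := (p, 0)) (b := (t, l))]
  have h2 : (∑ i, ∑ j, ∑ k, ∑ l,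
      if MonoCross E.pos E.color (p, i) (q, j) (p, k) (t, l) then 1 else 0) =
      ∑ j, ∑ l, if D.color s(p, q) = D.color s(p, t) ∧
        0 < side (E.pos (p, 0)) (E.pos (p, 1)) (E.pos (q, j)) *
          side (E.pos (p, 0)) (E.pos (p, 1)) (E.pos (t, l)) then 1 else 0 := by
    simp only [← h1, Fin.sum_univ_two, h0, if_false]
    ring
  rw [h2]
  by_cases hχ : D.color s(p, q) = D.color s(p, t)
  · simp only [hχ, true_and, pathWeight, hpq, hpt, hqt, ne_eq, not_false_eq_true, if_true]
    by_cases hq : q = D.mate p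
    · rw [if_pos (Or.inl hq), Finset.sum_comm]
      subst hq
      simp only [Fin.sum_univ_two]
      rw [ite_pos_add_ite_pos (hE.side_pair_mate_neg hD p) (hE.side_pair_ne_zero hD hpt.symm 0),
        ite_pos_add_ite_pos (hE.side_pair_mate_neg hD p) (hE.side_pair_ne_zero hD hpt.symm 1)]
    by_cases ht : t = D.mate p
    · rw [if_pos (Or.inr ht)]
      subst ht
      have hc : ∀ j l, side (E.pos (p, 0)) (E.pos (p, 1)) (E.pos (q, j)) *
          side (E.pos (p, 0)) (E.pos (p, 1)) (E.pos (D.mate p, l)) =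
          side (E.pos (p, 0)) (E.pos (p, 1)) (E.pos (D.mate p, l)) *
          side (E.pos (p, 0)) (E.pos (p, 1)) (E.pos (q, j)) := fun _ _ => mul_comm _ _
      simp only [Fin.sum_univ_two, hc]
      rw [ite_pos_add_ite_pos (hE.side_pair_mate_neg hD p) (hE.side_pair_ne_zero hD hpq.symm 0),
        ite_pos_add_ite_pos (hE.side_pair_mate_neg hD p) (hE.side_pair_ne_zero hD hpq.symm 1)]
    · simp only [hq, ht, or_self, if_false,
        mul_pos_iff_of_mul_pos (hE.side_pair_pos hD hpq.symm hq _)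
          (hE.side_pair_pos hD hpt.symm ht _), Fin.sum_univ_two]
      split_ifs <;> rfl
  · simp [hχ, pathWeight]

open scoped Classical in
theorem monoCross_pair_add (hE : IsDuplication D E) (hD : IsHalvingDrawing D) {p q : V}
    (hpq : p ≠ q) (hqp : p ≠ D.mate q) :
    ((if MonoCross E.pos E.color (p, 0) (q, 0) (p, 1) (q, 1) then 1 else 0) +
      if MonoCross E.pos E.color (p, 0) (q, 1) (p, 1) (q, 0) then 1 else 0) =
      if q = D.mate p then 0 else 1 := by
  have h := monoCross_add_monoCross (P := E.pos) (χ := E.color) (a := (p, 0)) (a' := (p, 1))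
      (b := (q, 0)) (d := (q, 1))
      (by rw [hE.color_between _ _ _ _ hpq, hE.color_between _ _ _ _ hpq])
      (by rw [hE.color_between _ _ _ _ hpq, hE.color_between _ _ _ _ hpq])
      (mul_pos_of_mul_pos_left (hE.side_pair_pos hD hpq hqp 0) (hE.side_pair_pos hD hpq hqp 1))
      (hE.side_pair_ne_zero hD hpq.symm 0) (hE.side_pair_ne_zero hD hpq.symm 1)
  rw [h, hE.color_between _ _ _ _ hpq, hE.color_between _ _ _ _ hpq]
  by_cases hq : q = D.mate p
  · subst hq
    simp [(hE.side_pair_mate_neg hD p).not_gt]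
  · simp [hq, mul_pos_of_mul_pos_left (hE.side_pair_pos hD hpq.symm hq 0)
      (hE.side_pair_pos hD hpq.symm hq 1)]

open scoped Classical in
theorem sum_monoCross_pair (hE : IsDuplication D E) (hD : IsHalvingDrawing D) {p q : V}
    (hpq : p ≠ q) :
    (∑ i, ∑ j, ∑ k, ∑ l, if MonoCross E.pos E.color (p, i) (q, j) (p, k) (q, l) then 1 else 0) =
      pairWeight D p q := by
  have h0 : ∀ i j l, ¬ MonoCross E.pos E.color (p, i) (q, j) (p, i) (q, l) :=
    fun i j l h => h.ne rfl
  have h0' : ∀ i j k, ¬ MonoCross E.pos E.color (p, i) (q, j) (p, k) (q, j) :=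
    fun i j l h => (MonoCross.swap_left.2 (MonoCross.swap_right.2 h)).ne rfl
  have h1 : (∑ i, ∑ j, ∑ k, ∑ l,
      if MonoCross E.pos E.color (p, i) (q, j) (p, k) (q, l) then 1 else 0) =
      2 * ((if MonoCross E.pos E.color (p, 0) (q, 0) (p, 1) (q, 1) then 1 else 0) +
        if MonoCross E.pos E.color (p, 0) (q, 1) (p, 1) (q, 0) then 1 else 0) := by
    simp only [Fin.sum_univ_two, h0, h0', if_false,
      MonoCross.symm (a := (p, (0 : Fin 2))) (c := (p, (1 : Fin 2)))]
    ring
  rw [h1]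
  by_cases hqp : p = D.mate q
  · have hqp' : q ≠ D.mate p := fun h => hD.mate_mate_ne q (by rw [← hqp, ← h])
    -- Exchange the roles of `p` and `q`.
    have h := hE.monoCross_pair_add hD hpq.symm hqp'
    rw [if_pos hqp, ← MonoCross.swap_left, ← MonoCross.swap_right, ← MonoCross.symm (c := (q, 1)),
      ← MonoCross.swap_left (a := (q, 1)), ← MonoCross.swap_right (c := (q, 0))] at h
    rw [h]
    simp [pairWeight, hqp]
  · rw [hE.monoCross_pair_add hD hpq hqp]
    by_cases hq : q = D.mate p <;> simp [pairWeight, hpq, hqp, hq]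

/-- Edges between duplicates of four different points cross exactly when the original edges do. -/
theorem monoCross_iff (hE : IsDuplication D E) {p q r t : V} (hpq : p ≠ q) (hpr : p ≠ r)
    (hpt : p ≠ t) (hqr : q ≠ r) (hqt : q ≠ t) (hrt : r ≠ t) (i j k l : Fin 2) :
    MonoCross E.pos E.color (p, i) (q, j) (r, k) (t, l) ↔ MonoCross D.pos D.color p q r t := by
  have aux : ∀ {s t x y : ℝ}, 0 < s * x → 0 < t * y → (x * y < 0 ↔ s * t < 0) := by
    intro s t x y hx hy
    have := mul_pos_iff_of_mul_pos (s := s) (t := -t) (x := x) (y := -y) hx (by simpa using hy)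
    simpa using this
  unfold MonoCross
  rw [hE.color_between _ _ _ _ hpq, hE.color_between _ _ _ _ hrt,
    aux (hE.near p q r i j k hpq hpr hqr) (hE.near p q t i j l hpq hpt hqt),
    aux (hE.near r t p k l i hrt hpr.symm hpt.symm) (hE.near r t q k l j hrt hqr.symm hqt.symm)]

open scoped Classical in
/-- Classification of the ordered quadruples of duplicates by the coincidences among the original
points. -/
theorem sum_monoCross (hE : IsDuplication D E) (hD : IsHalvingDrawing D) (p q r t : V) :
    (∑ i, ∑ j, ∑ k, ∑ l, if MonoCross E.pos E.color (p, i) (q, j) (r, k) (t, l) then 1 else 0) =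
      16 * (if MonoCross D.pos D.color p q r t then 1 else 0) +
      (if p = r then pathWeight D p q t else 0) + (if p = t then pathWeight D p q r else 0) +
      (if q = r then pathWeight D q p t else 0) + (if q = t then pathWeight D q p r else 0) +
      (if p = r then if q = t then pairWeight D p q else 0 else 0) +
      (if p = t then if q = r then pairWeight D p q else 0 else 0) := by
  have n1 : ∀ p q, pathWeight D p q p = 0 := fun p q => by simp [pathWeight]
  have n2 : ∀ p q, pathWeight D p p q = 0 := fun p q => by simp [pathWeight]
  have n3 : ∀ p q, pathWeight D p q q = 0 := fun p q => by simp [pathWeight]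
  have n4 : ∀ p, pairWeight D p p = 0 := fun p => by simp [pairWeight]
  have x1 : ∀ q r t, ¬ MonoCross D.pos D.color q q r t := fun q r t h => h.left_ne rfl
  have x2 : ∀ q r t, ¬ MonoCross D.pos D.color q t r r := fun q r t h =>
    (MonoCross.symm.2 h).left_ne rfl
  have x3 : ∀ p q t, ¬ MonoCross D.pos D.color p q p t := fun p q t h => h.ne rfl
  have x4 : ∀ p q t, ¬ MonoCross D.pos D.color p q t p := fun p q t h =>
    (MonoCross.swap_right.2 h).ne rfl
  have x5 : ∀ p q t, ¬ MonoCross D.pos D.color q p p t := fun p q t h =>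
    (MonoCross.swap_left.2 h).ne rfl
  have x6 : ∀ p q t, ¬ MonoCross D.pos D.color q p t p := fun p q t h =>
    (MonoCross.swap_left.2 (MonoCross.swap_right.2 h)).ne rfl
  by_cases hpq : p = q
  · subst hpq
    simp only [hE.not_monoCross_pair hD, x1, n2, n4, if_false, Finset.sum_const_zero]
    simp
  by_cases hrt : r = t
  · subst hrt
    simp only [← MonoCross.symm (c := (r, _)), hE.not_monoCross_pair hD, x2, if_false,
      Finset.sum_const_zero]
    by_cases hpr : p = r <;> by_cases hqr : q = r <;> simp [hpr, hqr, n1, n4]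
  by_cases hpr : p = r
  · subst hpr
    by_cases hqt : q = t
    · subst hqt
      rw [hE.sum_monoCross_pair hD hpq]
      simp [x3, n3, hpq, Ne.symm hpq]
    · rw [hE.sum_monoCross_path hD hpq hrt hqt]
      simp [x3, hrt, hqt, Ne.symm hpq]
  by_cases hpt : p = t
  · subst hpt
    have hc : ∀ i j k l, MonoCross E.pos E.color (p, i) (q, j) (r, k) (p, l) ↔
        MonoCross E.pos E.color (p, i) (q, j) (p, l) (r, k) := fun _ _ _ _ => MonoCross.swap_right
    have hs : ∀ i j, (∑ k, ∑ l,
        if MonoCross E.pos E.color (p, i) (q, j) (p, l) (r, k) then 1 else 0) =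
        ∑ l, ∑ k, if MonoCross E.pos E.color (p, i) (q, j) (p, l) (r, k) then 1 else 0 :=
      fun i j => Finset.sum_comm
    simp only [hc, hs]
    by_cases hqr : q = r
    · subst hqr
      rw [hE.sum_monoCross_pair hD hpq]
      simp [x4, n3, hpq, Ne.symm hpq]
    · rw [hE.sum_monoCross_path hD hpq hpr hqr]
      simp [x4, hpr, hqr, Ne.symm hpq]
  by_cases hqr : q = r
  · subst hqr
    have hc : ∀ i j k l, MonoCross E.pos E.color (p, i) (q, j) (q, k) (t, l) ↔
        MonoCross E.pos E.color (q, j) (p, i) (q, k) (t, l) := fun _ _ _ _ => MonoCross.swap_left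
    simp only [hc]
    rw [Finset.sum_comm, hE.sum_monoCross_path hD (Ne.symm hpq) hrt hpt]
    simp [x5, hpq, hpt, hrt]
  by_cases hqt : q = t
  · subst hqt
    have hc : ∀ i j k l, MonoCross E.pos E.color (p, i) (q, j) (r, k) (q, l) ↔
        MonoCross E.pos E.color (q, j) (p, i) (q, l) (r, k) :=
      fun _ _ _ _ => MonoCross.swap_right.trans MonoCross.swap_left
    have hs : ∀ i j, (∑ k, ∑ l,
        if MonoCross E.pos E.color (q, j) (p, i) (q, l) (r, k) then 1 else 0) =
        ∑ l, ∑ k, if MonoCross E.pos E.color (q, j) (p, i) (q, l) (r, k) then 1 else 0 :=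
      fun i j => Finset.sum_comm
    simp only [hc, hs]
    rw [Finset.sum_comm, hE.sum_monoCross_path hD (Ne.symm hpq) hqr hpr]
    simp [x6, hpq, hpr, hqr]
  · simp [hE.monoCross_iff hpq hpr hpt hqr hqt hrt, hpr, hpt, hqr, hqt]

open scoped Classical in
theorem orderedCrossings_eq_add [Fintype V] (hE : IsDuplication D E) (hD : IsHalvingDrawing D) :
    orderedCrossings E.pos E.color = 16 * orderedCrossings D.pos D.color +
      4 * (∑ p, ∑ q, ∑ t, pathWeight D p q t) + 2 * ∑ p, ∑ q, pairWeight D p q := by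
  have h1 : orderedCrossings E.pos E.color = ∑ p, ∑ q, ∑ r, ∑ t, ∑ i, ∑ j, ∑ k, ∑ l,
      if MonoCross E.pos E.color (p, i) (q, j) (r, k) (t, l) then 1 else 0 := by
    simp only [orderedCrossings, Fintype.sum_prod_type]
    refine Finset.sum_congr rfl fun p _ => ?_
    rw [Finset.sum_comm]
    refine Finset.sum_congr rfl fun q _ => ?_
    have h : ∀ i j, (∑ r, ∑ k, ∑ t, ∑ l,
        if MonoCross E.pos E.color (p, i) (q, j) (r, k) (t, l) then 1 else 0) =
        ∑ r, ∑ t, ∑ k, ∑ l,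
          if MonoCross E.pos E.color (p, i) (q, j) (r, k) (t, l) then 1 else 0 :=
      fun i j => Finset.sum_congr rfl fun r _ => Finset.sum_comm
    simp only [h]
    simp only [Finset.sum_comm (s := (Finset.univ : Finset (Fin 2)))
      (t := (Finset.univ : Finset V))]
  simp only [h1, hE.sum_monoCross hD, Finset.sum_add_distrib, ← Finset.mul_sum, Finset.sum_ite_eq,
    Finset.mem_univ, if_true, Finset.sum_ite_irrel, Finset.sum_const_zero]
  have hc : (∑ p, ∑ q, ∑ t, pathWeight D q p t) = ∑ p, ∑ q, ∑ t, pathWeight D p q t :=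
    Finset.sum_comm
  rw [orderedCrossings]
  linarith

end IsDuplication
end

/-! ### Profiles and local weights -/

section
variable {V : Type}

theorem ncard_setOf_eq_sum {α : Type} [Fintype α] (s : α → Prop) [DecidablePred s] :
    {x | s x}.ncard = ∑ x, if s x then 1 else 0 := by
  rw [Set.ncard_eq_toFinset_card', Set.toFinset_ofPred, Finset.card_filter]

/-- The number of edges of colour `c` at `p` to the left (`ε = 1`) or to the right (`ε = -1`) of
the line spanned by `p` and `q` and directed from `q` to `p`. -/
noncomputable def colorSideCount (P : V → Plane) (χ : Sym2 V → Bool) (c : Bool) (ε : ℝ)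
    (p q : V) : ℕ :=
  {r : V | r ≠ p ∧ χ s(p, r) = c ∧ 0 < ε * side (P q) (P p) (P r)}.ncard

theorem colorSideCount_largerColor_one (P : V → Plane) (χ : Sym2 V → Bool) (p q : V) :
    colorSideCount P χ (largerColor χ p) 1 p q = largerLeft P χ p q := by
  simp [colorSideCount, largerLeft]

theorem colorSideCount_largerColor_neg_one (P : V → Plane) (χ : Sym2 V → Bool) (p q : V) :
    colorSideCount P χ (largerColor χ p) (-1) p q = largerRight P χ p q := by
  simp [colorSideCount, largerRight]

/-- The numerical data at a point that drive the duplication process. -/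
@[ext] structure Profile where
  /-- Whether the matching edge is in the larger colour class. -/
  larger : Bool
  /-- The number of edges of the larger class to the left of the matching edge. -/
  largerLeft : ℕ
  /-- The number of edges of the larger class to the right of the matching edge. -/
  largerRight : ℕ
  /-- The number of edges of the smaller class to the left of the matching edge. -/
  smallerLeft : ℕ
  /-- The number of edges of the smaller class to the right of the matching edge. -/
  smallerRight : ℕ

/-- The profile of a point of a matched drawing. -/
noncomputable def MatchedDrawing.profile (D : MatchedDrawing V) (p : V) : Profile where
  larger := decide (D.color s(p, D.mate p) = largerColor D.color p)
  largerLeft := largerLeft D.pos D.color p (D.mate p)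
  largerRight := largerRight D.pos D.color p (D.mate p)
  smallerLeft := colorSideCount D.pos D.color (!largerColor D.color p) 1 p (D.mate p)
  smallerRight := colorSideCount D.pos D.color (!largerColor D.color p) (-1) p (D.mate p)

namespace Profile

/-- The profile of the duplicate with index `i` of a point with profile `τ`.  All four numbers are
doubled, and the other duplicate of the point and the duplicates of the matched point may add one
on either side.  The branches follow the cases of the duplication rule; the new matching edge is in
the same class as the old one, except for the first duplicate when a matching edge in the larger
class halves that class exactly. -/
def child (τ : Profile) (i : Fin 2) : Profile :=
  if τ.largerRight < τ.largerLeft then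
    ⟨τ.larger, 2 * τ.largerLeft, 2 * τ.largerRight + 1,
      2 * τ.smallerLeft + i, 2 * τ.smallerRight + (1 - i)⟩
  else if τ.largerLeft < τ.largerRight then
    ⟨τ.larger, 2 * τ.largerLeft + 1, 2 * τ.largerRight,
      2 * τ.smallerLeft + (1 - i), 2 * τ.smallerRight + i⟩
  else if τ.larger then
    if i = 0 then
      ⟨false, 2 * τ.largerLeft + 1, 2 * τ.largerRight + 1,
        2 * τ.smallerLeft, 2 * τ.smallerRight⟩
    else
      ⟨true, 2 * τ.largerLeft, 2 * τ.largerRight + 1,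
        2 * τ.smallerLeft + 1, 2 * τ.smallerRight⟩
  else
    ⟨false, 2 * τ.largerLeft, 2 * τ.largerRight,
      2 * τ.smallerLeft + 1, 2 * τ.smallerRight + 1⟩

/-- The number of edges in the colour class of the matching edge, without the matching edge. -/
def mateClass (τ : Profile) : ℕ :=
  if τ.larger then τ.largerLeft + τ.largerRight else τ.smallerLeft + τ.smallerRight

/-- The number of edges other than the matching edge. -/
def edges (τ : Profile) : ℕ :=
  τ.largerLeft + τ.largerRight + τ.smallerLeft + τ.smallerRight

/-- The sum of the squares of the four class sizes. -/
def squares (τ : Profile) : ℕ :=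
  τ.largerLeft ^ 2 + τ.largerRight ^ 2 + τ.smallerLeft ^ 2 + τ.smallerRight ^ 2

end Profile

theorem colorDegree_add [Fintype V] (χ : Sym2 V → Bool) (p : V) :
    colorDegree χ false p + colorDegree χ true p + 1 = Fintype.card V := by
  classical
  have h : ∀ r, ((if r ≠ p ∧ χ s(p, r) = false then 1 else 0) +
      (if r ≠ p ∧ χ s(p, r) = true then 1 else 0)) + (if p = r then 1 else 0) = 1 := by
    intro r
    by_cases hr : r = p
    · simp [hr]
    · cases χ s(p, r) <;> simp [hr, Ne.symm hr]
  have := Finset.sum_congr rfl fun r (_ : r ∈ (Finset.univ : Finset V)) => h r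
  simp only [Finset.sum_add_distrib, Finset.sum_ite_eq, Finset.mem_univ, if_true] at this
  rw [colorDegree, colorDegree, ncard_setOf_eq_sum, ncard_setOf_eq_sum, this]
  simp

open scoped Classical in
/-- A pair of edges at `p` has weight 4 if it has the same colour and lies on the same side of the
matching edge, and weight 2 if one of the two is the matching edge and the colours agree. -/
theorem sum_pathWeight [Fintype V] {D : MatchedDrawing V} (hD : IsHalvingDrawing D) (p : V) :
    (∑ q, ∑ t, pathWeight D p q t) + 4 * (D.profile p).edges =
      4 * (D.profile p).squares + 4 * (D.profile p).mateClass := by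
  let u : Bool → ℝ → V → ℕ := fun c ε q =>
    if q ≠ p ∧ D.color s(p, q) = c ∧ 0 < ε * side (D.pos (D.mate p)) (D.pos p) (D.pos q)
      then 1 else 0
  have hu : ∀ c ε, ∑ q, u c ε q = colorSideCount D.pos D.color c ε p (D.mate p) := by
    intro c ε
    rw [colorSideCount, ncard_setOf_eq_sum]
  have hside : ∀ {q}, q ≠ p → q ≠ D.mate p →
      side (D.pos (D.mate p)) (D.pos p) (D.pos q) ≠ 0 := fun hq hq' =>
    hD.generalPosition.side_ne_zero (hD.mate_ne p) hq'.symm hq.symm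
  have key : ∀ q t, pathWeight D p q t + (if q = t then
      4 * (u true 1 q + u true (-1) q + u false 1 q + u false (-1) q) else 0) =
      4 * (u true 1 q * u true 1 t + u true (-1) q * u true (-1) t +
        u false 1 q * u false 1 t + u false (-1) q * u false (-1) t) +
      (if q = D.mate p then 2 * (u (D.color s(p, D.mate p)) 1 t +
        u (D.color s(p, D.mate p)) (-1) t) else 0) +
      (if t = D.mate p then 2 * (u (D.color s(p, D.mate p)) 1 q +
        u (D.color s(p, D.mate p)) (-1) q) else 0) := by
    intro q t
    have hup : ∀ c ε, u c ε p = 0 := fun c ε => by simp [u]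
    have hum : ∀ c ε, u c ε (D.mate p) = 0 := fun c ε => by simp [u]
    have hadd : ∀ {c q}, q ≠ p → q ≠ D.mate p →
        u c 1 q + u c (-1) q = if D.color s(p, q) = c then 1 else 0 := by
      intro c q hq hq'
      rcases (hside hq hq').lt_or_gt with h | h <;> simp [u, hq, h, h.not_gt]
    by_cases hqp : q = p
    · subst hqp
      simp [hup, (hD.mate_ne q).symm, pathWeight]
    by_cases htp : t = p
    · subst htp
      simp [hup, (hD.mate_ne t).symm, pathWeight, hqp]
    by_cases hqt : q = t
    · subst hqt
      have husq : ∀ c ε, u c ε q * u c ε q = u c ε q := fun c ε => by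
        simp only [u]; split_ifs <;> rfl
      by_cases hq : q = D.mate p
      · subst hq
        simp [hum, pathWeight]
      · simp [husq, pathWeight, hq]
    by_cases hq : q = D.mate p
    · subst hq
      have ht : t ≠ D.mate p := Ne.symm hqt
      simp [hum, hadd htp ht, ht, pathWeight, Ne.symm hqp, Ne.symm htp, hqt,
        eq_comm (a := D.color s(p, t))]
    by_cases ht : t = D.mate p
    · subst ht
      simp [hum, hadd hqp hq, hq, pathWeight, Ne.symm hqp, Ne.symm htp]
    · have e := side_swap_left (D.pos (D.mate p)) (D.pos p)
      simp only [pathWeight, e, neg_mul_neg, hqt, hq, ht, if_false, add_zero, or_self, u]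
      rcases (hside hqp hq).lt_or_gt with h1 | h1 <;>
      rcases (hside htp ht).lt_or_gt with h2 | h2 <;>
      rcases D.color s(p, q) with _ | _ <;> rcases D.color s(p, t) with _ | _ <;>
      simp [hqp, htp, Ne.symm hqp, Ne.symm htp, hqt, h1, h2, h1.not_gt, h2.not_gt, mul_pos_iff]
  have h := Finset.sum_congr rfl fun q (_ : q ∈ (Finset.univ : Finset V)) =>
    Finset.sum_congr rfl fun t (_ : t ∈ (Finset.univ : Finset V)) => key q t
  simp only [Finset.sum_add_distrib, ← Finset.mul_sum, Finset.sum_ite_eq, Finset.sum_ite_eq',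
    Finset.mem_univ, if_true, Finset.sum_ite_irrel, Finset.sum_const_zero, ← Finset.sum_mul,
    hu] at h
  simp only [MatchedDrawing.profile, Profile.edges, Profile.squares, Profile.mateClass,
    ← colorSideCount_largerColor_one, ← colorSideCount_largerColor_neg_one]
  rcases hL : largerColor D.color p with _ | _ <;>
  rcases he : D.color s(p, D.mate p) with _ | _ <;> rw [he] at h <;>
  simp only [Bool.not_true, Bool.not_false, decide_true, decide_false, if_true, if_false,
    reduceCtorEq, Bool.false_eq_true] <;>
  linarith

open scoped Classical in
theorem sum_pairWeight [Fintype V] {D : MatchedDrawing V} (hD : IsHalvingDrawing D) :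
    (∑ p, ∑ q, pairWeight D p q) + 6 * Fintype.card V = 2 * Fintype.card V ^ 2 := by
  have key : ∀ p q, pairWeight D p q + (if q = p then 2 else 0) + (if q = D.mate p then 2 else 0) +
      (if p = D.mate q then 2 else 0) = 2 := by
    intro p q
    by_cases hqp : q = p
    · subst hqp
      simp [pairWeight, (hD.mate_ne q).symm]
    by_cases hq : q = D.mate p
    · subst hq
      simp [pairWeight, hD.mate_ne p, (hD.mate_mate_ne p).symm]
    · by_cases hp : p = D.mate q <;> simp [pairWeight, hqp, Ne.symm hqp, hq, hp]
      subst hp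
      exact ⟨by simpa using hqp, (hD.mate_mate_ne q).symm⟩
  have h := Finset.sum_congr rfl fun p (_ : p ∈ (Finset.univ : Finset V)) =>
    Finset.sum_congr rfl fun q (_ : q ∈ (Finset.univ : Finset V)) => key p q
  have hc : (∑ p : V, ∑ q : V, if p = D.mate q then 2 else 0) =
      ∑ q : V, ∑ p : V, if p = D.mate q then 2 else 0 := Finset.sum_comm
  simp only [Finset.sum_add_distrib, hc] at h
  simp only [Finset.sum_ite_eq', Finset.mem_univ, if_true, Finset.sum_const, Finset.card_univ,
    smul_eq_mul] at h
  linarith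

/-- The number of crossings after a duplication step. -/
theorem IsDuplication.monoCrossings_eq [Fintype V] {D : MatchedDrawing V}
    {E : MatchedDrawing (V × Fin 2)} (hE : IsDuplication D E) (hD : IsHalvingDrawing D) :
    (monoCrossings E.pos E.color : ℚ) = 16 * monoCrossings D.pos D.color +
      ∑ p, (2 * (D.profile p).squares - 2 * (D.profile p).edges + 2 * (D.profile p).mateClass : ℚ) +
      ((Fintype.card V : ℚ) ^ 2 - 3 * Fintype.card V) / 2 := by
  classical
  have h := hE.orderedCrossings_eq_add hD
  rw [orderedCrossings_eq (hE.generalPosition hD), orderedCrossings_eq hD.generalPosition] at h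
  have h1 := Finset.sum_congr rfl fun p (_ : p ∈ (Finset.univ : Finset V)) => sum_pathWeight hD p
  have h2 := sum_pairWeight hD
  simp only [Finset.sum_add_distrib, ← Finset.mul_sum] at h1
  simp only [Finset.sum_add_distrib, Finset.sum_sub_distrib, ← Finset.mul_sum]
  have h' := congrArg (Nat.cast (R := ℚ)) h
  have h1' := congrArg (Nat.cast (R := ℚ)) h1
  have h2' := congrArg (Nat.cast (R := ℚ)) h2
  push_cast at h' h1' h2'
  linarith

end

/-! ### Evolution of the profiles -/

section
variable {V : Type}

theorem neg_of_mul_pos_of_mul_neg {s x y : ℝ} (hx : 0 < s * x) (hy : s * y < 0) : x * y < 0 := by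
  have := mul_pos_of_mul_pos_left hx (y := -y) (by linarith)
  linarith

theorem mul_pos_congr {s x ε : ℝ} (h : 0 < s * x) : 0 < ε * x ↔ 0 < ε * s := by
  rcases mul_pos_iff.1 h with ⟨h1, h2⟩ | ⟨h1, h2⟩ <;>
  simp [mul_pos_iff, h1, h2, h1.not_gt, h2.not_gt]

open scoped Classical in
theorem ite_pos_add_ite_pos_left {ε x y : ℝ} (hε : ε ≠ 0) (h : x * y < 0) :
    ((if 0 < ε * x then 1 else 0) + if 0 < ε * y then 1 else 0) = 1 := by
  rcases mul_neg_iff.1 h with ⟨hx, hy⟩ | ⟨hx, hy⟩ <;> rcases hε.lt_or_gt with h | h <;>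
  simp [mul_pos_iff, hx, hy, h, hx.not_gt, hy.not_gt, h.not_gt]

theorem Profile.child_balanced {τ : Profile} (h1 : τ.largerLeft ≤ τ.largerRight + 1)
    (h2 : τ.largerRight ≤ τ.largerLeft + 1) (i : Fin 2) :
    (τ.child i).largerLeft ≤ (τ.child i).largerRight + 1 ∧
      (τ.child i).largerRight ≤ (τ.child i).largerLeft + 1 := by
  unfold Profile.child
  split_ifs <;> dsimp only <;> omega

namespace IsDuplication
variable {D : MatchedDrawing V} {E : MatchedDrawing (V × Fin 2)}

theorem color_self_pair (p : V) (i : Fin 2) :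
    E.color s((p, i), (p, 1 - i)) = E.color s((p, 0), (p, 1)) := by
  fin_cases i
  · rfl
  · exact congrArg E.color Sym2.eq_swap

open scoped Classical in
theorem colorDegree_eq [Fintype V] (hE : IsDuplication D E) (c : Bool) (p : V) (i : Fin 2) :
    colorDegree E.color c (p, i) = 2 * colorDegree D.color c p +
      if E.color s((p, 0), (p, 1)) = c then 1 else 0 := by
  rw [colorDegree, colorDegree, ncard_setOf_eq_sum, ncard_setOf_eq_sum, Fintype.sum_prod_type,
    Finset.mul_sum]
  have h : ∀ r, (∑ k, if (r, k) ≠ (p, i) ∧ E.color s((p, i), (r, k)) = c then 1 else 0) =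
      2 * (if r ≠ p ∧ D.color s(p, r) = c then 1 else 0) +
      (if r = p then if E.color s((p, 0), (p, 1)) = c then 1 else 0 else 0) := by
    intro r
    by_cases hr : r = p
    · subst hr
      rw [← color_self_pair r i, Fin.sum_univ_two]
      fin_cases i <;> simp
    · simp only [hE.color_between _ _ _ _ (Ne.symm hr), ne_eq, Prod.mk.injEq, hr, false_and,
        not_false_eq_true, true_and, if_false, add_zero]
      simp
  simp only [h, Finset.sum_add_distrib, Finset.sum_ite_eq', Finset.mem_univ, if_true]

theorem largerColor_eq [Fintype V] (hE : IsDuplication D E) (heven : Even (Fintype.card V)) (p : V)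
    (i : Fin 2) : largerColor E.color (p, i) = largerColor D.color p := by
  have h := colorDegree_add D.color p
  obtain ⟨n, hn⟩ := heven
  rw [largerColor, largerColor, hE.colorDegree_eq, hE.colorDegree_eq]
  congr 1
  rw [eq_iff_iff]
  split_ifs <;> omega

open scoped Classical in
/-- The edges at a duplicate of `p` on one side of a new matching edge: those on that side of the
old matching edge are doubled, and there may be contributions of the other duplicate of `p` and of
the duplicates of the point matched with `p`. -/
theorem colorSideCount_eq [Fintype V] (hE : IsDuplication D E) (hD : IsHalvingDrawing D) (c : Bool)
    (ε : ℝ) (p : V) (i : Fin 2) (x : V × Fin 2)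
    (hx : ∀ r k, r ≠ p → r ≠ D.mate p → 0 < side (D.pos (D.mate p)) (D.pos p) (D.pos r) *
      side (E.pos x) (E.pos (p, i)) (E.pos (r, k))) :
    colorSideCount E.pos E.color c ε (p, i) x =
      2 * colorSideCount D.pos D.color c ε p (D.mate p) +
      (if E.color s((p, 0), (p, 1)) = c ∧
        0 < ε * side (E.pos x) (E.pos (p, i)) (E.pos (p, 1 - i)) then 1 else 0) +
      (if D.color s(p, D.mate p) = c then
        ∑ k, if 0 < ε * side (E.pos x) (E.pos (p, i)) (E.pos (D.mate p, k)) then 1 else 0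
        else 0) := by
  rw [colorSideCount, colorSideCount, ncard_setOf_eq_sum, ncard_setOf_eq_sum,
    Fintype.sum_prod_type, Finset.mul_sum]
  have h : ∀ r, (∑ k, if (r, k) ≠ (p, i) ∧ E.color s((p, i), (r, k)) = c ∧
        0 < ε * side (E.pos x) (E.pos (p, i)) (E.pos (r, k)) then 1 else 0) =
      2 * (if r ≠ p ∧ D.color s(p, r) = c ∧
        0 < ε * side (D.pos (D.mate p)) (D.pos p) (D.pos r) then 1 else 0) +
      (if r = p then if E.color s((p, 0), (p, 1)) = c ∧
        0 < ε * side (E.pos x) (E.pos (p, i)) (E.pos (p, 1 - i)) then 1 else 0 else 0) +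
      (if r = D.mate p then if D.color s(p, D.mate p) = c then
        ∑ k, if 0 < ε * side (E.pos x) (E.pos (p, i)) (E.pos (D.mate p, k)) then 1 else 0
        else 0 else 0) := by
    intro r
    by_cases hr : r = p
    · subst hr
      rw [← color_self_pair r i, Fin.sum_univ_two]
      fin_cases i <;> simp [(hD.mate_ne r).symm]
    by_cases hr' : r = D.mate p
    · subst hr'
      simp only [hE.color_between _ _ _ _ (Ne.symm hr), ne_eq, Prod.mk.injEq, hr, false_and,
        not_false_eq_true, true_and, if_false, if_true, side_self_left, mul_zero, lt_self_iff_false,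
        and_false, add_zero, zero_add]
      split_ifs with hc <;> simp [hc]
    · simp only [hE.color_between _ _ _ _ (Ne.symm hr), ne_eq, Prod.mk.injEq, hr, hr', false_and,
        not_false_eq_true, true_and, if_false, add_zero, mul_pos_congr (hx r _ hr hr')]
      simp
  simp only [h, Finset.sum_add_distrib, Finset.sum_ite_eq', Finset.mem_univ, if_true]

open scoped Classical in
/-- The counts at the first duplicate of `p` when it is matched with the second one. -/
theorem colorSideCount_pair [Fintype V] (hE : IsDuplication D E) (hD : IsHalvingDrawing D)
    (c : Bool) {ε : ℝ} (hε : ε ≠ 0) (p : V) :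
    colorSideCount E.pos E.color c ε (p, 0) (p, 1) =
      2 * colorSideCount D.pos D.color c ε p (D.mate p) +
      if D.color s(p, D.mate p) = c then 1 else 0 := by
  rw [hE.colorSideCount_eq hD c ε p 0 (p, 1)]
  · have h : side (E.pos (p, 1)) (E.pos (p, 0)) (E.pos (D.mate p, 0)) *
        side (E.pos (p, 1)) (E.pos (p, 0)) (E.pos (D.mate p, 1)) < 0 := by
      rw [side_swap_left (E.pos (p, 0)), side_swap_left (E.pos (p, 0)), neg_mul_neg]
      exact hE.side_pair_mate_neg hD p
    rw [Fin.sum_univ_two, ite_pos_add_ite_pos_left hε h]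
    simp
  · intro r k hr hr'
    rw [side_swap_left (E.pos (p, 0)), side_swap_left (D.pos p), neg_mul_neg]
    exact hE.side_pair_pos hD hr hr' k

/-- The duplicates of the point `q` matched with `p` lie on the same sides of an edge from a
duplicate of `q` to a duplicate of `p` as of the matching edge, apart from the endpoint. -/
theorem side_mate_mate (hE : IsDuplication D E) (hD : IsHalvingDrawing D) (p : V) (i k : Fin 2) :
    side (D.pos (D.mate p)) (D.pos p) (E.pos (D.mate p, k)) *
      side (E.pos (D.mate p, k)) (E.pos (p, i)) (E.pos (D.mate p, 1 - k)) < 0 := by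
  have h1 := hE.side_pair_pos hD (p := D.mate p) (r := p) (hD.mate_ne p).symm
    (hD.mate_mate_ne p).symm i
  obtain ⟨t, ht, h01⟩ := hE.exists_param hD
  obtain ⟨ht0, ht1⟩ := h01 (D.mate p)
  rw [ht, side_lineMap, side_self_left, mul_zero, zero_add, ← ht]
  have e : side (D.pos (D.mate p)) (D.pos p) (D.pos (D.mate (D.mate p))) =
      -side (D.pos (D.mate p)) (D.pos (D.mate (D.mate p))) (D.pos p) := side_swap_right _ _ _
  rw [e]
  fin_cases k
  · change t (D.mate p) 0 * _ * side (E.pos (D.mate p, 0)) (E.pos (p, i)) (E.pos (D.mate p, 1)) < 0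
    rw [side_swap_right (E.pos (D.mate p, 0)) (E.pos (D.mate p, 1))]
    have := mul_neg_of_neg_of_pos ht0 h1
    linarith
  · change t (D.mate p) 1 * _ * side (E.pos (D.mate p, 1)) (E.pos (p, i)) (E.pos (D.mate p, 0)) < 0
    rw [← side_rotate (E.pos (D.mate p, 1)), ← side_rotate (E.pos (p, i))]
    have := mul_pos ht1 h1
    linarith

/-- An edge from a duplicate of the point matched with `p` to the first or second duplicate of `p`
has the other duplicate of `p` on the opposite or on the same side, respectively. -/
theorem side_mate_pair (hE : IsDuplication D E) (hD : IsHalvingDrawing D) (p : V) (k : Fin 2)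
    (h : side (D.pos (D.mate p)) (D.pos p) (E.pos (D.mate p, k)) ≠ 0) :
    side (D.pos (D.mate p)) (D.pos p) (E.pos (D.mate p, k)) *
      side (E.pos (D.mate p, k)) (E.pos (p, 0)) (E.pos (p, 1)) < 0 ∧
    0 < side (D.pos (D.mate p)) (D.pos p) (E.pos (D.mate p, k)) *
      side (E.pos (D.mate p, k)) (E.pos (p, 1)) (E.pos (p, 0)) := by
  have h1 := hE.side_pair_mate hD p k h
  rw [side_swap_right (E.pos (D.mate p, k)) (E.pos (p, 0)), ← side_rotate (E.pos (D.mate p, k))]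
  exact ⟨h1, by linarith⟩

open scoped Classical in
/-- The counts at a duplicate of `p` when it is matched with a duplicate of the point `q` matched
with `p`, on the side of this duplicate of `q`. -/
theorem colorSideCount_near_side [Fintype V] (hE : IsDuplication D E) (hD : IsHalvingDrawing D)
    (c : Bool) {ε : ℝ} (p : V) (i k : Fin 2)
    (h : 0 < side (D.pos (D.mate p)) (D.pos p) (E.pos (D.mate p, k)) * ε) :
    colorSideCount E.pos E.color c ε (p, i) (D.mate p, k) =
      2 * colorSideCount D.pos D.color c ε p (D.mate p) +
      if i = 1 ∧ E.color s((p, 0), (p, 1)) = c then 1 else 0 := by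
  obtain ⟨h0, h1⟩ := hE.side_mate_pair hD p k (left_ne_zero_of_mul h.ne')
  have h2 := (neg_of_mul_pos_of_mul_neg h (hE.side_mate_mate hD p i k)).not_gt
  replace h0 := (neg_of_mul_pos_of_mul_neg h h0).not_gt
  replace h1 := mul_pos_of_mul_pos_left h h1
  rw [hE.colorSideCount_eq hD c ε p i (D.mate p, k) fun r l hr hr' =>
    hE.near (D.mate p) p r k i l (hD.mate_ne p) (Ne.symm hr') (Ne.symm hr), Fin.sum_univ_two]
  fin_cases i <;> fin_cases k <;> simp_all [not_lt.2]

open scoped Classical in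
/-- The counts at a duplicate of `p` when it is matched with a duplicate of the point `q` matched
with `p`, on the side opposite to this duplicate of `q`. -/
theorem colorSideCount_far_side [Fintype V] (hE : IsDuplication D E) (hD : IsHalvingDrawing D)
    (c : Bool) {ε : ℝ} (p : V) (i k : Fin 2)
    (h : 0 < side (D.pos (D.mate p)) (D.pos p) (E.pos (D.mate p, k)) * -ε) :
    colorSideCount E.pos E.color c ε (p, i) (D.mate p, k) =
      2 * colorSideCount D.pos D.color c ε p (D.mate p) +
      (if i = 0 ∧ E.color s((p, 0), (p, 1)) = c then 1 else 0) +
      if D.color s(p, D.mate p) = c then 1 else 0 := by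
  obtain ⟨h0, h1⟩ := hE.side_mate_pair hD p k (left_ne_zero_of_mul h.ne')
  have h2 := neg_of_mul_pos_of_mul_neg h (hE.side_mate_mate hD p i k)
  replace h0 := neg_of_mul_pos_of_mul_neg h h0
  replace h1 := mul_pos_of_mul_pos_left h h1
  rw [neg_mul, neg_lt_zero] at h0 h2
  rw [neg_mul, neg_pos] at h1
  replace h1 := h1.not_gt
  rw [hE.colorSideCount_eq hD c ε p i (D.mate p, k) fun r l hr hr' =>
    hE.near (D.mate p) p r k i l (hD.mate_ne p) (Ne.symm hr') (Ne.symm hr), Fin.sum_univ_two]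
  fin_cases i <;> fin_cases k <;> simp_all

/-- How the duplicates of `p` are matched, with the duplicates of the point matched with `p` on the
two sides of the matching edge made explicit. -/
theorem exists_duplicateMates (hE : IsDuplication D E) (hD : IsHalvingDrawing D) (p : V) :
    ∃ kL kR, 0 < side (D.pos (D.mate p)) (D.pos p) (E.pos (D.mate p, kL)) ∧
      side (D.pos (D.mate p)) (D.pos p) (E.pos (D.mate p, kR)) < 0 ∧
      DuplicateMates (D.color s(p, D.mate p) = largerColor D.color p)
        (largerLeft D.pos D.color p (D.mate p)) (largerRight D.pos D.color p (D.mate p))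
        (p, 1) (D.mate p, kL) (D.mate p, kR) (E.mate (p, 0)) (E.mate (p, 1)) := by
  rcases mul_neg_iff.1 (hE.side_mate_neg hD p) with h | h
  · exact ⟨0, 1, h.1, h.2, hE.mates p 0 1 h.1 h.2⟩
  · exact ⟨1, 0, h.2, h.1, hE.mates p 1 0 h.2 h.1⟩

/-- The profile of a duplicate depends only on the profile of the original point. -/
theorem profile_eq [Fintype V] (hE : IsDuplication D E) (hD : IsHalvingDrawing D)
    (heven : Even (Fintype.card V)) (p : V) (i : Fin 2) :
    E.profile (p, i) = (D.profile p).child i := by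
  classical
  obtain ⟨kL, kR, hL, hR, m1, m2, m3, m4, m5, m6⟩ := hE.exists_duplicateMates hD p
  have hpq := (hD.mate_ne p).symm
  have hlc := hE.largerColor_eq heven p
  have hleft : ∀ i, E.mate (p, i) = (D.mate p, kL) → E.profile (p, i) =
      ⟨(D.profile p).larger,
        2 * (D.profile p).largerLeft +
          (if i = 1 ∧ E.color s((p, 0), (p, 1)) = largerColor D.color p then 1 else 0),
        2 * (D.profile p).largerRight +
          (if i = 0 ∧ E.color s((p, 0), (p, 1)) = largerColor D.color p then 1 else 0) +
          (if D.color s(p, D.mate p) = largerColor D.color p then 1 else 0),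
        2 * (D.profile p).smallerLeft +
          (if i = 1 ∧ E.color s((p, 0), (p, 1)) = !largerColor D.color p then 1 else 0),
        2 * (D.profile p).smallerRight +
          (if i = 0 ∧ E.color s((p, 0), (p, 1)) = !largerColor D.color p then 1 else 0) +
          (if D.color s(p, D.mate p) = !largerColor D.color p then 1 else 0)⟩ := by
    intro i h
    simp only [MatchedDrawing.profile, ← colorSideCount_largerColor_one,
      ← colorSideCount_largerColor_neg_one, hlc, h, hE.color_between p (D.mate p) _ _ hpq,
      hE.colorSideCount_near_side hD _ p i kL (ε := 1) (by linarith),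
      hE.colorSideCount_far_side hD _ p i kL (ε := -1) (by linarith)]
  have hright : ∀ i, E.mate (p, i) = (D.mate p, kR) → E.profile (p, i) =
      ⟨(D.profile p).larger,
        2 * (D.profile p).largerLeft +
          (if i = 0 ∧ E.color s((p, 0), (p, 1)) = largerColor D.color p then 1 else 0) +
          (if D.color s(p, D.mate p) = largerColor D.color p then 1 else 0),
        2 * (D.profile p).largerRight +
          (if i = 1 ∧ E.color s((p, 0), (p, 1)) = largerColor D.color p then 1 else 0),
        2 * (D.profile p).smallerLeft +
          (if i = 0 ∧ E.color s((p, 0), (p, 1)) = !largerColor D.color p then 1 else 0) +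
          (if D.color s(p, D.mate p) = !largerColor D.color p then 1 else 0),
        2 * (D.profile p).smallerRight +
          (if i = 1 ∧ E.color s((p, 0), (p, 1)) = !largerColor D.color p then 1 else 0)⟩ := by
    intro i h
    simp only [MatchedDrawing.profile, ← colorSideCount_largerColor_one,
      ← colorSideCount_largerColor_neg_one, hlc, h, hE.color_between p (D.mate p) _ _ hpq,
      hE.colorSideCount_far_side hD _ p i kR (ε := 1) (by linarith),
      hE.colorSideCount_near_side hD _ p i kR (ε := -1) (by linarith)]
  have hpair : E.mate (p, 0) = (p, 1) → E.profile (p, 0) =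
      ⟨decide (E.color s((p, 0), (p, 1)) = largerColor D.color p),
        2 * (D.profile p).largerLeft +
          (if D.color s(p, D.mate p) = largerColor D.color p then 1 else 0),
        2 * (D.profile p).largerRight +
          (if D.color s(p, D.mate p) = largerColor D.color p then 1 else 0),
        2 * (D.profile p).smallerLeft +
          (if D.color s(p, D.mate p) = !largerColor D.color p then 1 else 0),
        2 * (D.profile p).smallerRight +
          (if D.color s(p, D.mate p) = !largerColor D.color p then 1 else 0)⟩ := by
    intro h
    simp only [MatchedDrawing.profile, ← colorSideCount_largerColor_one,
      ← colorSideCount_largerColor_neg_one, hlc, h,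
      hE.colorSideCount_pair hD _ (ε := 1) (by norm_num) p,
      hE.colorSideCount_pair hD _ (ε := -1) (by norm_num) p]
  have hi : i = 0 ∨ i = 1 := by omega
  have hl : (D.profile p).largerLeft = largerLeft D.pos D.color p (D.mate p) := rfl
  have hr : (D.profile p).largerRight = largerRight D.pos D.color p (D.mate p) := rfl
  have hlg : (D.profile p).larger = decide (D.color s(p, D.mate p) = largerColor D.color p) := rfl
  rw [← hl, ← hr] at m1 m2 m3 m4 m5 m6
  by_cases he : D.color s(p, D.mate p) = largerColor D.color p
  · have hcol := hE.color_pair_smaller p (Or.inl he)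
    rcases lt_trichotomy (D.profile p).largerRight (D.profile p).largerLeft with hlt | heq | hlt
    · obtain ⟨e0, e1⟩ := m4 he hlt
      rcases hi with rfl | rfl
      · simp [hleft 0 e0, Profile.child, hcol, he, hlt]
      · simp [hleft 1 e1, Profile.child, hcol, he, hlt]
    · obtain ⟨e0, e1⟩ := m5 he heq.symm
      rcases hi with rfl | rfl
      · simp [hpair e0, Profile.child, hcol, he, heq, hlg]
      · simp [hleft 1 e1, Profile.child, hcol, he, heq, hlg]
    · obtain ⟨e0, e1⟩ := m6 he hlt
      rcases hi with rfl | rfl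
      · simp [hright 0 e0, Profile.child, hcol, he, hlt, hlt.not_gt]
      · simp [hright 1 e1, Profile.child, hcol, he, hlt, hlt.not_gt]
  · have he' : D.color s(p, D.mate p) = !largerColor D.color p := by
      revert he
      cases D.color s(p, D.mate p) <;> cases largerColor D.color p <;> simp
    rcases lt_trichotomy (D.profile p).largerRight (D.profile p).largerLeft with hlt | heq | hlt
    · obtain ⟨e0, e1⟩ := m1 he hlt
      have hcol := hE.color_pair_larger p he (by rw [← hl, ← hr]; exact hlt.ne')
      rcases hi with rfl | rfl
      · simp [hleft 0 e0, Profile.child, hcol, he', hlt]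
      · simp [hright 1 e1, Profile.child, hcol, he', hlt]
    · obtain ⟨e0, e1⟩ := m2 he heq.symm
      have hcol := hE.color_pair_smaller p (Or.inr heq.symm)
      rcases hi with rfl | rfl
      · simp [hpair e0, Profile.child, hcol, he', heq, hlg]
      · simp [hright 1 e1, Profile.child, hcol, he', heq, hlg]
    · obtain ⟨e0, e1⟩ := m3 he hlt
      have hcol := hE.color_pair_larger p he (by rw [← hl, ← hr]; exact hlt.ne)
      rcases hi with rfl | rfl
      · simp [hright 0 e0, Profile.child, hcol, he', hlt, hlt.not_gt]
      · simp [hleft 1 e1, Profile.child, hcol, he', hlt, hlt.not_gt]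

theorem mate_eq (hE : IsDuplication D E) (hD : IsHalvingDrawing D) (p : V) (i : Fin 2) :
    E.mate (p, i) = (p, 1) ∧ i = 0 ∨ ∃ k, E.mate (p, i) = (D.mate p, k) := by
  obtain ⟨kL, kR, -, -, m1, m2, m3, m4, m5, m6⟩ := hE.exists_duplicateMates hD p
  have hi : i = 0 ∨ i = 1 := by omega
  by_cases he : D.color s(p, D.mate p) = largerColor D.color p <;>
  rcases lt_trichotomy (largerRight D.pos D.color p (D.mate p))
    (largerLeft D.pos D.color p (D.mate p)) with hlt | heq | hlt
  · rcases hi with rfl | rfl <;> simp [m4 he hlt]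
  · rcases hi with rfl | rfl <;> simp [m5 he heq.symm]
  · rcases hi with rfl | rfl <;> simp [m6 he hlt]
  · rcases hi with rfl | rfl <;> simp [m1 he hlt]
  · rcases hi with rfl | rfl <;> simp [m2 he heq.symm]
  · rcases hi with rfl | rfl <;> simp [m3 he hlt]

/-- A duplication step preserves the hypotheses under which it can be performed. -/
theorem isHalvingDrawing [Fintype V] (hE : IsDuplication D E) (hD : IsHalvingDrawing D)
    (heven : Even (Fintype.card V)) : IsHalvingDrawing E := by
  refine ⟨hE.generalPosition hD, ?_, ?_⟩
  · rintro ⟨p, i⟩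
    refine ⟨?_, ?_⟩
    · rcases hE.mate_eq hD p i with ⟨h, rfl⟩ | ⟨k, h⟩
      · simp [h]
      · simp [h, hD.mate_ne p]
    · have hp := (hD.matching.1 p).2
      have h := Profile.child_balanced (τ := D.profile p) hp.1 hp.2 i
      rwa [← hE.profile_eq hD heven p i] at h
  · rintro ⟨p, i⟩ ⟨q, j⟩ h
    simp only [Sym2.eq_iff] at h
    rcases h with ⟨h, -⟩ | ⟨h1, h2⟩
    · exact h
    · rcases hE.mate_eq hD p i with ⟨hp, rfl⟩ | ⟨k, hp⟩ <;>
      rcases hE.mate_eq hD q j with ⟨hq, rfl⟩ | ⟨l, hq⟩ <;>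
      simp only [hp, hq, Prod.mk.injEq] at h1 h2
      · exact absurd h1.2 (by decide)
      · exact absurd (h1.1.symm.trans h2.1) (hD.mate_ne q)
      · exact absurd (h2.1.trans h1.1.symm) (hD.mate_ne p)
      · exact absurd (by rw [h2.1]; exact h1.1.symm) (hD.mate_mate_ne p)

end IsDuplication
end

/-! ### Existence of duplications -/

section
variable {V : Type}

theorem Continuous.side {f g h : ℝ → Plane} (hf : Continuous f) (hg : Continuous g)
    (hh : Continuous h) : Continuous fun t => side (f t) (g t) (h t) := by
  unfold _root_.side
  fun_prop

open scoped Classical in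
theorem IsHalvingDrawing.exists_isDuplication [Finite V] {D : MatchedDrawing V}
    (hD : IsHalvingDrawing D) : ∃ E, IsDuplication D E := by
  let pos : ℝ → V × Fin 2 → Plane := fun ε x =>
    AffineMap.lineMap (D.pos x.1) (D.pos (D.mate x.1)) (if x.2 = 0 then -ε else ε)
  have hcont : ∀ x, Continuous fun ε => pos ε x := by
    intro x
    simp only [pos]
    split_ifs
    · exact AffineMap.lineMap_continuous.comp continuous_neg
    · exact AffineMap.lineMap_continuous
  have hpos0 : ∀ x, pos 0 x = D.pos x.1 := fun x => by simp [pos]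
  have hev : ∀ p q r : V, p ≠ q → p ≠ r → q ≠ r → ∀ {f g h : ℝ → Plane}, Continuous f →
      Continuous g → Continuous h → f 0 = D.pos p → g 0 = D.pos q → h 0 = D.pos r →
      ∀ᶠ ε in nhds (0 : ℝ), 0 < side (D.pos p) (D.pos q) (D.pos r) * side (f ε) (g ε) (h ε) := by
    intro p q r hpq hpr hqr f g h hf hg hh f0 g0 h0
    have hc := (continuous_const (y := side (D.pos p) (D.pos q) (D.pos r))).mul (hf.side hg hh)
    refine hc.continuousAt.eventually (lt_mem_nhds ?_)
    simp only [Pi.mul_apply, f0, g0, h0]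
    exact mul_self_pos.2 (hD.generalPosition.side_ne_zero hpq hpr hqr)
  have hnear : ∀ᶠ ε in nhds (0 : ℝ), ∀ p q r i j k, p ≠ q → p ≠ r → q ≠ r →
      0 < side (D.pos p) (D.pos q) (D.pos r) *
        side (pos ε (p, i)) (pos ε (q, j)) (pos ε (r, k)) := by
    simp only [eventually_all]
    intro p q r i j k hpq hpr hqr
    exact hev p q r hpq hpr hqr (hcont _) (hcont _) (hcont _) (hpos0 _) (hpos0 _) (hpos0 _)
  have hside : ∀ᶠ ε in nhds (0 : ℝ), ∀ p q r i, p ≠ q → p ≠ r → q ≠ r →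
      0 < side (D.pos q) (D.pos r) (D.pos p) * side (D.pos q) (D.pos r) (pos ε (p, i)) := by
    simp only [eventually_all]
    intro p q r i hpq hpr hqr
    exact hev q r p hqr hpq.symm hpr.symm continuous_const continuous_const (hcont _) rfl rfl
      (hpos0 _)
  obtain ⟨ε, ⟨hn, hs⟩, hε⟩ := (((hnear.and hside).filter_mono nhdsWithin_le_nhds).and
    (self_mem_nhdsWithin (a := (0 : ℝ)) (s := Set.Ioi 0))).exists
  have hε : 0 < ε := hε
  have hopp : ∀ p r, r ≠ p → r ≠ D.mate p →
      side (D.pos p) (D.pos r) (pos ε (p, 0)) * side (D.pos p) (D.pos r) (pos ε (p, 1)) < 0 := by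
    intro p r hr hr'
    have h0 := hD.generalPosition.side_ne_zero hr.symm (hD.mate_ne p).symm hr'
    simp only [pos, side_lineMap, side_self_left, mul_zero, zero_add, if_true, one_ne_zero,
      if_false]
    have : 0 < (ε * side (D.pos p) (D.pos r) (D.pos (D.mate p))) ^ 2 := by positivity
    linarith
  -- The colour of the short edge at `p`, and the matching, as the duplication prescribes them.
  let pairColor : V → Bool := fun p =>
    if D.color s(p, D.mate p) ≠ largerColor D.color p ∧
      largerLeft D.pos D.color p (D.mate p) ≠ largerRight D.pos D.color p (D.mate p)
    then largerColor D.color p else !largerColor D.color p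
  have hmates : ∀ p, ∃ n : Fin 2 → V × Fin 2, ∀ i j,
      0 < side (D.pos (D.mate p)) (D.pos p) (pos ε (D.mate p, i)) →
      side (D.pos (D.mate p)) (D.pos p) (pos ε (D.mate p, j)) < 0 →
      DuplicateMates (D.color s(p, D.mate p) = largerColor D.color p)
        (largerLeft D.pos D.color p (D.mate p)) (largerRight D.pos D.color p (D.mate p))
        (p, 1) (D.mate p, i) (D.mate p, j) (n 0) (n 1) := by
    intro p
    have hex : ∀ qL qR : V × Fin 2, ∃ n : Fin 2 → V × Fin 2,
        DuplicateMates (D.color s(p, D.mate p) = largerColor D.color p)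
          (largerLeft D.pos D.color p (D.mate p)) (largerRight D.pos D.color p (D.mate p))
          (p, 1) qL qR (n 0) (n 1) := by
      intro qL qR
      unfold DuplicateMates
      generalize largerLeft D.pos D.color p (D.mate p) = l
      generalize largerRight D.pos D.color p (D.mate p) = r
      by_cases he : D.color s(p, D.mate p) = largerColor D.color p <;>
      rcases lt_trichotomy r l with h | rfl | h
      · exact ⟨![qL, qL], by simp [he, h, h.ne', h.not_gt]⟩
      · exact ⟨![(p, 1), qL], by simp [he]⟩
      · exact ⟨![qR, qR], by simp [he, h, h.ne, h.not_gt]⟩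
      · exact ⟨![qL, qR], by simp [he, h, h.ne', h.not_gt]⟩
      · exact ⟨![(p, 1), qR], by simp [he]⟩
      · exact ⟨![qR, qL], by simp [he, h, h.ne, h.not_gt]⟩
    have hq := hopp (D.mate p) p (hD.mate_ne p).symm (hD.mate_mate_ne p).symm
    rcases mul_neg_iff.1 hq with ⟨h0, h1⟩ | ⟨h0, h1⟩
    · obtain ⟨n, hn⟩ := hex (D.mate p, 0) (D.mate p, 1)
      refine ⟨n, fun i j hi hj => ?_⟩
      obtain rfl : i = 0 := by
        by_contra hi0
        obtain rfl : i = 1 := by omega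
        exact h1.not_gt hi
      obtain rfl : j = 1 := by
        by_contra hj1
        obtain rfl : j = 0 := by omega
        exact h0.not_gt hj
      exact hn
    · obtain ⟨n, hn⟩ := hex (D.mate p, 1) (D.mate p, 0)
      refine ⟨n, fun i j hi hj => ?_⟩
      obtain rfl : i = 1 := by
        by_contra hi0
        obtain rfl : i = 0 := by omega
        exact h0.not_gt hi
      obtain rfl : j = 0 := by
        by_contra hj1
        obtain rfl : j = 1 := by omega
        exact h1.not_gt hj
      exact hn
  choose n hn' using hmates
  refine ⟨⟨pos ε, Sym2.lift ⟨fun a b => if a.1 = b.1 then pairColor a.1 else D.color s(a.1, b.1),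
    fun a b => ?_⟩, fun x => n x.1 x.2⟩, ?_⟩
  · by_cases h : a.1 = b.1
    · simp [h]
    · simp [h, Ne.symm h, Sym2.eq_swap]
  · constructor
    · exact fun p i => AffineMap.lineMap_mem_affineSpan_pair _ _ _
    · exact hopp
    · exact hs
    · intro p
      have hd : 0 < dist (D.pos p) (D.pos (D.mate p)) :=
        dist_pos.2 (hD.generalPosition.1.ne (hD.mate_ne p).symm)
      simp only [pos, dist_lineMap_right, if_true, one_ne_zero, if_false, Real.norm_eq_abs]
      refine mul_lt_mul_of_pos_right ?_ hd
      rw [abs_of_pos (by linarith : (0 : ℝ) < 1 - -ε), abs_lt]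
      constructor <;> linarith
    · exact hn
    · intro p q i j hpq
      simp [hpq]
    · intro p h1 h2
      simp [pairColor, h1, h2]
    · intro p h
      have : ¬(D.color s(p, D.mate p) ≠ largerColor D.color p ∧
          largerLeft D.pos D.color p (D.mate p) ≠ largerRight D.pos D.color p (D.mate p)) := by
        tauto
      simp only [Sym2.lift_mk, if_true, pairColor, this, if_false]
    · exact fun p i j hi hj => hn' p i j hi hj

end

/-! ### Iterating the duplication -/

namespace Profile

/-- The matching edge halves the larger class up to one edge, and it does so exactly only if it
belongs to the smaller class.  All profiles that occur after a duplication step have this form. -/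
def IsStable (τ : Profile) : Prop :=
  τ.largerLeft ≤ τ.largerRight + 1 ∧ τ.largerRight ≤ τ.largerLeft + 1 ∧
    (τ.largerLeft = τ.largerRight → τ.larger = false)

theorem isStable_child {τ : Profile} (h1 : τ.largerLeft ≤ τ.largerRight + 1)
    (h2 : τ.largerRight ≤ τ.largerLeft + 1) (i : Fin 2) : (τ.child i).IsStable := by
  refine ⟨(child_balanced h1 h2 i).1, (child_balanced h1 h2 i).2, ?_⟩
  unfold child
  split_ifs <;> dsimp only <;> first | omega | simp

/-- The contribution of a point to the number of crossings created by a duplication step. -/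
def weight (τ : Profile) : ℚ :=
  2 * τ.squares - 2 * τ.edges + 2 * τ.mateClass

/-- The part of `weight` that is multiplied by `8` when a point with stable profile is duplicated.
The constants make it an eigenfunction, see `IsStable.cubicPart_child`. -/
def cubicPart (τ : Profile) : ℚ :=
  if τ.largerLeft = τ.largerRight then 2 * τ.squares + 4 * τ.mateClass + 4
  else 2 * τ.squares + 2 * τ.edges + 4 / 3

/-- The part of `weight` that is multiplied by `4` when a point with stable profile is
duplicated. -/
def quadraticPart (τ : Profile) : ℚ :=
  if τ.largerLeft = τ.largerRight then -2 * τ.mateClass - 2 * τ.edges - 8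
  else -4 * τ.edges + 2 * τ.mateClass - 6

/-- The part of `weight` that is multiplied by `2` when a point with stable profile is
duplicated. -/
def linearPart (τ : Profile) : ℚ :=
  if τ.largerLeft = τ.largerRight then 4 else 14 / 3

theorem weight_eq (τ : Profile) :
    τ.weight = τ.cubicPart + τ.quadraticPart + τ.linearPart := by
  unfold weight cubicPart quadraticPart linearPart
  split_ifs <;> ring

/-- The number of edges of the larger class on the two sides differ by one, or the matching edge
halves the larger class exactly and is in the smaller class. -/
theorem IsStable.cases {τ : Profile} (h : τ.IsStable) :
    (∃ g r a b, τ = ⟨g, r + 1, r, a, b⟩) ∨ (∃ g l a b, τ = ⟨g, l, l + 1, a, b⟩) ∨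
      ∃ l a b, τ = ⟨false, l, l, a, b⟩ := by
  obtain ⟨g, l, r, a, b⟩ := τ
  obtain ⟨h1, h2, h3⟩ := h
  dsimp only at h1 h2 h3
  rcases lt_trichotomy l r with h | rfl | h
  · obtain rfl : r = l + 1 := by omega
    exact Or.inr (Or.inl ⟨g, l, a, b, rfl⟩)
  · exact Or.inr (Or.inr ⟨l, a, b, by rw [h3 rfl]⟩)
  · obtain rfl : l = r + 1 := by omega
    exact Or.inl ⟨g, r, a, b, rfl⟩

theorem IsStable.cubicPart_child {τ : Profile} (h : τ.IsStable) :
    (τ.child 0).cubicPart + (τ.child 1).cubicPart = 8 * τ.cubicPart := by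
  rcases h.cases with ⟨g, r, a, b, rfl⟩ | ⟨g, l, a, b, rfl⟩ | ⟨l, a, b, rfl⟩
  · have h1 : 2 * (r + 1) ≠ 2 * r + 1 := by omega
    simp [child, cubicPart, squares, edges, h1]
    ring
  · have h1 : 2 * l + 1 ≠ 2 * (l + 1) := by omega
    simp [child, cubicPart, squares, edges, h1]
    ring
  · simp [child, cubicPart, squares, mateClass]
    ring

theorem IsStable.quadraticPart_child {τ : Profile} (h : τ.IsStable) :
    (τ.child 0).quadraticPart + (τ.child 1).quadraticPart = 4 * τ.quadraticPart := by
  rcases h.cases with ⟨g, r, a, b, rfl⟩ | ⟨g, l, a, b, rfl⟩ | ⟨l, a, b, rfl⟩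
  · have h1 : 2 * (r + 1) ≠ 2 * r + 1 := by omega
    cases g <;> simp [child, quadraticPart, mateClass, edges, h1] <;> ring
  · have h1 : 2 * l + 1 ≠ 2 * (l + 1) := by omega
    cases g <;> simp [child, quadraticPart, mateClass, edges, h1] <;> ring
  · simp [child, quadraticPart, edges, mateClass]
    ring

theorem IsStable.linearPart_child {τ : Profile} (h : τ.IsStable) :
    (τ.child 0).linearPart + (τ.child 1).linearPart = 2 * τ.linearPart := by
  rcases h.cases with ⟨g, r, a, b, rfl⟩ | ⟨g, l, a, b, rfl⟩ | ⟨l, a, b, rfl⟩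
  · have h1 : 2 * (r + 1) ≠ 2 * r + 1 := by omega
    simp [child, linearPart, h1]
    ring
  · have h1 : 2 * l + 1 ≠ 2 * (l + 1) := by omega
    simp [child, linearPart, h1]
    ring
  · simp [child, linearPart]
    ring

end Profile

section
variable {V : Type}

theorem IsDuplication.sum_profile [Fintype V] {D : MatchedDrawing V}
    {E : MatchedDrawing (V × Fin 2)} (hE : IsDuplication D E) (hD : IsHalvingDrawing D)
    (heven : Even (Fintype.card V)) (g : Profile → ℚ) :
    ∑ x, g (E.profile x) = ∑ p, (g ((D.profile p).child 0) + g ((D.profile p).child 1)) := by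
  simp only [Fintype.sum_prod_type, Fin.sum_univ_two, hE.profile_eq hD heven]

theorem IsDuplication.isStable_profile [Fintype V] {D : MatchedDrawing V}
    {E : MatchedDrawing (V × Fin 2)} (hE : IsDuplication D E) (hD : IsHalvingDrawing D)
    (heven : Even (Fintype.card V)) (x : V × Fin 2) : (E.profile x).IsStable := by
  obtain ⟨p, i⟩ := x
  rw [hE.profile_eq hD heven]
  exact Profile.isStable_child (hD.matching.1 p).2.1 (hD.matching.1 p).2.2 i

noncomputable instance DupIndex.instFintype [Fintype V] : ∀ k, Fintype (DupIndex V k)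
  | 0 => inferInstanceAs (Fintype V)
  | k + 1 =>
    letI := DupIndex.instFintype k
    inferInstanceAs (Fintype (DupIndex V k × Fin 2))

theorem DupIndex.card [Fintype V] (k : ℕ) :
    Fintype.card (DupIndex V k) = Fintype.card V * 2 ^ k := by
  induction k with
  | zero => exact (mul_one _).symm
  | succ k ih =>
    change Fintype.card (DupIndex V k × Fin 2) = _
    rw [Fintype.card_prod, ih, Fintype.card_fin, pow_succ, mul_assoc]

theorem DupIndex.even_card [Fintype V] (h : Even (Fintype.card V)) (k : ℕ) :
    Even (Fintype.card (DupIndex V k)) := by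
  rw [DupIndex.card]
  exact h.mul_right _

theorem IsHalvingDrawing.exists_isDuplicationSequence [Fintype V] {D : MatchedDrawing V}
    (hD : IsHalvingDrawing D) (heven : Even (Fintype.card V)) :
    ∃ Q : (k : ℕ) → MatchedDrawing (DupIndex V k), IsDuplicationSequence D Q := by
  have step : ∀ (k : ℕ) (E : {E : MatchedDrawing (DupIndex V k) // IsHalvingDrawing E}),
      ∃ E' : {E : MatchedDrawing (DupIndex V (k + 1)) // IsHalvingDrawing E},
        IsDuplication E.1 E'.1 := by
    rintro k ⟨E, hE⟩
    obtain ⟨E', hE'⟩ := hE.exists_isDuplication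
    exact ⟨⟨E', hE'.isHalvingDrawing hE (DupIndex.even_card heven k)⟩, hE'⟩
  choose next hnext using step
  let R : (k : ℕ) → {E : MatchedDrawing (DupIndex V k) // IsHalvingDrawing E} := fun k =>
    Nat.rec ⟨D, hD⟩ next k
  exact ⟨fun k => (R k).1, rfl, fun k => hnext k (R k)⟩

namespace IsDuplicationSequence
variable [Fintype V] {D : MatchedDrawing V} {Q : (k : ℕ) → MatchedDrawing (DupIndex V k)}

theorem isHalvingDrawing (hQ : IsDuplicationSequence D Q) (hD : IsHalvingDrawing D)
    (heven : Even (Fintype.card V)) (k : ℕ) : IsHalvingDrawing (Q k) := by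
  induction k with
  | zero => rw [hQ.1]; exact hD
  | succ k ih => exact (hQ.2 k).isHalvingDrawing ih (DupIndex.even_card heven k)

theorem sum_profile_one (hQ : IsDuplicationSequence D Q) (hD : IsHalvingDrawing D)
    (heven : Even (Fintype.card V)) (g : Profile → ℚ) :
    ∑ x, g ((Q 1).profile x) = ∑ p, (g ((D.profile p).child 0) + g ((D.profile p).child 1)) := by
  have h := (hQ.2 0).sum_profile (hQ.isHalvingDrawing hD heven 0) (DupIndex.even_card heven 0) g
  rw [hQ.1] at h
  exact h

/-- From the first step on, a quantity that is multiplied by `c` by the duplication of a point with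
stable profile grows geometrically. -/
theorem sum_profile_succ (hQ : IsDuplicationSequence D Q) (hD : IsHalvingDrawing D)
    (heven : Even (Fintype.card V)) (g : Profile → ℚ) (c : ℚ)
    (hg : ∀ τ : Profile, τ.IsStable → g (τ.child 0) + g (τ.child 1) = c * g τ) (k : ℕ) :
    ∑ x, g ((Q (k + 1)).profile x) =
      c ^ k * ∑ p, (g ((D.profile p).child 0) + g ((D.profile p).child 1)) := by
  induction k with
  | zero => rw [hQ.sum_profile_one hD heven g, pow_zero, one_mul]
  | succ k ih =>
    have h := (hQ.2 (k + 1)).sum_profile (hQ.isHalvingDrawing hD heven (k + 1))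
      (DupIndex.even_card heven (k + 1)) g
    have hst : ∀ x, ((Q (k + 1)).profile x).IsStable :=
      (hQ.2 k).isStable_profile (hQ.isHalvingDrawing hD heven k) (DupIndex.even_card heven k)
    refine h.trans ?_
    rw [Finset.sum_congr rfl fun x _ => hg _ (hst x), ← Finset.mul_sum, ih, pow_succ]
    ring

theorem monoCrossings_succ (hQ : IsDuplicationSequence D Q) (hD : IsHalvingDrawing D)
    (heven : Even (Fintype.card V)) (k : ℕ) :
    (monoCrossings (Q (k + 1)).pos (Q (k + 1)).color : ℚ) =
      16 * monoCrossings (Q k).pos (Q k).color + ∑ x, ((Q k).profile x).weight +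
      ((Fintype.card V * 2 ^ k : ℚ) ^ 2 - 3 * (Fintype.card V * 2 ^ k)) / 2 := by
  have h := (hQ.2 k).monoCrossings_eq (hQ.isHalvingDrawing hD heven k)
  rw [DupIndex.card] at h
  push_cast at h
  exact h

end IsDuplicationSequence

/-- The number of crossings after `k ≥ 1` duplication steps. -/
theorem IsHalvingDrawing.exists_monoCrossings_eq [Fintype V] {D : MatchedDrawing V}
    (hD : IsHalvingDrawing D) (heven : Even (Fintype.card V)) :
    ∃ a b c d : ℚ, ∀ Q : (k : ℕ) → MatchedDrawing (DupIndex V k),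
      IsDuplicationSequence D Q → ∀ k : ℕ, 1 ≤ k →
        (monoCrossings (Q k).pos (Q k).color : ℚ) =
          a * 2 ^ (4 * k) + b * 2 ^ (3 * k) + c * 2 ^ (2 * k) + d * 2 ^ k := by
  set n : ℚ := (Fintype.card V : ℚ)
  let S : (Profile → ℚ) → ℚ := fun g =>
    ∑ p, (g ((D.profile p).child 0) + g ((D.profile p).child 1))
  let x₁ : ℚ := 16 * monoCrossings D.pos D.color + ∑ p, (D.profile p).weight + (n ^ 2 - 3 * n) / 2
  -- The solution of `x (k + 1) = 16 x k + α 8 ^ k + β 4 ^ k + γ 2 ^ k`.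
  let b : ℚ := -(S Profile.cubicPart / 8) / 8
  let c : ℚ := -(S Profile.quadraticPart / 4 + n ^ 2 / 2) / 12
  let d : ℚ := -(S Profile.linearPart / 2 - 3 * n / 2) / 14
  refine ⟨(x₁ - 8 * b - 4 * c - 2 * d) / 16, b, c, d, fun Q hQ k hk => ?_⟩
  induction k, hk using Nat.le_induction with
  | base =>
    have h := hQ.monoCrossings_succ hD heven 0
    have h0 : (monoCrossings (Q 0).pos (Q 0).color : ℚ) = monoCrossings D.pos D.color := by
      rw [hQ.1]; rfl
    have h1 : ∑ x, ((Q 0).profile x).weight = ∑ p, (D.profile p).weight := by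
      rw [hQ.1]; rfl
    rw [h0, h1] at h
    rw [h]
    simp only [x₁, n]
    ring
  | succ k hk ih =>
    obtain ⟨k, rfl⟩ : ∃ j, k = j + 1 := ⟨k - 1, by omega⟩
    rw [hQ.monoCrossings_succ hD heven (k + 1), ih]
    simp only [Profile.weight_eq, Finset.sum_add_distrib]
    rw [hQ.sum_profile_succ hD heven _ 8 fun τ h => h.cubicPart_child,
      hQ.sum_profile_succ hD heven _ 4 fun τ h => h.quadraticPart_child,
      hQ.sum_profile_succ hD heven _ 2 fun τ h => h.linearPart_child]
    change _ + (8 ^ k * S _ + 4 ^ k * S _ + 2 ^ k * S _) + _ = _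
    have e8 : (8 : ℚ) ^ k = (2 ^ k) ^ 3 := by rw [← pow_mul, mul_comm, pow_mul]; norm_num
    have e4 : (4 : ℚ) ^ k = (2 ^ k) ^ 2 := by rw [← pow_mul, mul_comm, pow_mul]; norm_num
    have p4 : (2 : ℚ) ^ (4 * (k + 1)) = 16 * (2 ^ k) ^ 4 := by
      rw [← pow_mul, mul_comm k, mul_add, pow_add]; norm_num; ring
    have p3 : (2 : ℚ) ^ (3 * (k + 1)) = 8 * (2 ^ k) ^ 3 := by
      rw [← pow_mul, mul_comm k, mul_add, pow_add]; norm_num; ring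
    have p2 : (2 : ℚ) ^ (2 * (k + 1)) = 4 * (2 ^ k) ^ 2 := by
      rw [← pow_mul, mul_comm k, mul_add, pow_add]; norm_num; ring
    have q4 : (2 : ℚ) ^ (4 * (k + 1 + 1)) = 256 * (2 ^ k) ^ 4 := by
      rw [← pow_mul, mul_comm k, mul_add, mul_add, pow_add, pow_add]; norm_num; ring
    have q3 : (2 : ℚ) ^ (3 * (k + 1 + 1)) = 64 * (2 ^ k) ^ 3 := by
      rw [← pow_mul, mul_comm k, mul_add, mul_add, pow_add, pow_add]; norm_num; ring
    have q2 : (2 : ℚ) ^ (2 * (k + 1 + 1)) = 16 * (2 ^ k) ^ 2 := by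
      rw [← pow_mul, mul_comm k, mul_add, mul_add, pow_add, pow_add]; norm_num; ring
    rw [e8, e4, p4, p3, p2, q4, q3, q2, pow_succ (2 : ℚ) (k + 1), pow_succ (2 : ℚ) k]
    generalize (2 : ℚ) ^ k = t
    simp only [b, c, d, n]
    ring

/-- A drawing on any finite set of labels bounds the crossing density of smaller optimal
drawings. -/
theorem cr2K_mul_pow_le [Fintype V] {P : V → Plane} (hP : GeneralPosition P) (χ : Sym2 V → Bool)
    {n : ℕ} (hn : 4 ≤ n) (hnV : n ≤ Fintype.card V) :
    (cr2K n : ℝ) * ((Fintype.card V : ℝ) - 3) ^ 4 ≤ 24 * monoCrossings P χ * n.choose 4 := by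
  have e := Fintype.equivFin V
  have h1 := cr2K_mul_choose_le hn hnV (hP.comp e.symm.injective) (χ ∘ Sym2.map e.symm)
  rw [monoCrossings_comp_equiv hP] at h1
  have h2 := Nat.pow_sub_le_descFactorial (Fintype.card V) 4
  rw [Nat.descFactorial_eq_factorial_mul_choose, show (4 : ℕ).factorial = 24 from rfl] at h2
  have h3 : cr2K n * (Fintype.card V + 1 - 4) ^ 4 ≤ 24 * monoCrossings P χ * n.choose 4 := by
    calc _ ≤ cr2K n * (24 * (Fintype.card V).choose 4) := Nat.mul_le_mul_left _ h2
      _ = 24 * (cr2K n * (Fintype.card V).choose 4) := by ring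
      _ ≤ _ := by rw [mul_assoc]; exact Nat.mul_le_mul_left _ h1
  have h4 : ((Fintype.card V + 1 - 4 : ℕ) : ℝ) = (Fintype.card V : ℝ) - 3 := by
    rw [Nat.cast_sub (by omega)]
    push_cast
    ring
  rw [← h4]
  exact_mod_cast h3

end

theorem theorem1 (m : ℕ) (hm : Even m) (hm0 : 0 < m)
    (P : Fin m → Plane) (hP : GeneralPosition P)
    (χ : Sym2 (Fin m) → Bool) (M : Fin m → Fin m) (hM : IsHalvingMatching P χ M) :
    ∃ A B C D : ℚ,
      (∃ Q : (k : ℕ) → MatchedDrawing (DupIndex (Fin m) k),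
        IsDuplicationSequence ⟨P, χ, M⟩ Q) ∧
      (∀ Q : (k : ℕ) → MatchedDrawing (DupIndex (Fin m) k),
        IsDuplicationSequence ⟨P, χ, M⟩ Q → ∀ k : ℕ, 1 ≤ k →
          (monoCrossings (Q k).pos (Q k).color : ℚ) =
            A * 2 ^ (4 * k) + B * 2 ^ (3 * k) + C * 2 ^ (2 * k) + D * 2 ^ k) ∧
      ∃ f : ℕ → ℝ, (f =Θ[atTop] fun n : ℕ => (n : ℝ) ^ 3) ∧
        ∀ n : ℕ, (cr2K n : ℝ) ≤ 24 * (A : ℝ) / (m : ℝ) ^ 4 * (n.choose 4 : ℝ) + f n := by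
  have hD : IsHalvingDrawing (⟨P, χ, M⟩ : MatchedDrawing (Fin m)) := ⟨hP, hM⟩
  have heven : Even (Fintype.card (Fin m)) := by rwa [Fintype.card_fin]
  obtain ⟨a, b, c, d, hformula⟩ := hD.exists_monoCrossings_eq heven
  obtain ⟨Q, hQ⟩ := hD.exists_isDuplicationSequence heven
  refine ⟨a, b, c, d, ⟨Q, hQ⟩, hformula, fun n => (n : ℝ) ^ 3, isTheta_refl _ _, fun n => ?_⟩
  suffices h : (cr2K n : ℝ) ≤ 24 * (a : ℝ) / (m : ℝ) ^ 4 * (n.choose 4 : ℝ) from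
    h.trans (le_add_of_nonneg_right (by positivity))
  rcases lt_or_ge n 4 with hn | hn
  · rw [cr2K_eq_zero hn, Nat.choose_eq_zero_of_lt hn]
    simp
  have hm' : (0 : ℝ) < m := by exact_mod_cast hm0
  have hy : Tendsto (fun k : ℕ => ((1 : ℝ) / 2) ^ k) atTop (nhds 0) :=
    tendsto_pow_atTop_nhds_zero_of_lt_one (by norm_num) (by norm_num)
  -- Both sides of the inequality for the `k`-th drawing are divided by `2 ^ (4 * k)`.
  have hl : Tendsto (fun k : ℕ => (cr2K n : ℝ) * (m - 3 * (1 / 2) ^ k) ^ 4) atTop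
      (nhds ((cr2K n : ℝ) * (m - 3 * 0) ^ 4)) :=
    (((hy.const_mul 3).const_sub (m : ℝ)).pow 4).const_mul _
  have hr : Tendsto (fun k : ℕ => 24 * ((a : ℝ) + b * (1 / 2) ^ k + c * ((1 / 2) ^ k) ^ 2 +
      d * ((1 / 2) ^ k) ^ 3) * n.choose 4) atTop
      (nhds (24 * ((a : ℝ) + b * 0 + c * 0 ^ 2 + d * 0 ^ 3) * n.choose 4)) :=
    ((((tendsto_const_nhds.add (hy.const_mul _)).add ((hy.pow 2).const_mul _)).add
      ((hy.pow 3).const_mul _)).const_mul _).mul_const _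
  have hle : ∀ᶠ k : ℕ in atTop, (cr2K n : ℝ) * (m - 3 * (1 / 2) ^ k) ^ 4 ≤
      24 * ((a : ℝ) + b * (1 / 2) ^ k + c * ((1 / 2) ^ k) ^ 2 +
        d * ((1 / 2) ^ k) ^ 3) * n.choose 4 := by
    filter_upwards [eventually_ge_atTop (n + 1)] with k hk
    have hcard : Fintype.card (DupIndex (Fin m) k) = m * 2 ^ k := by
      rw [DupIndex.card, Fintype.card_fin]
    have hnk : n ≤ Fintype.card (DupIndex (Fin m) k) := by
      rw [hcard]
      calc n ≤ 2 ^ n := Nat.lt_two_pow_self.le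
        _ ≤ 2 ^ k := Nat.pow_le_pow_right (by norm_num) (by omega)
        _ ≤ m * 2 ^ k := Nat.le_mul_of_pos_left _ hm0
    have h := cr2K_mul_pow_le (hQ.isHalvingDrawing hD heven k).generalPosition (Q k).color hn hnk
    have hf : (monoCrossings (Q k).pos (Q k).color : ℝ) =
        a * 2 ^ (4 * k) + b * 2 ^ (3 * k) + c * 2 ^ (2 * k) + d * 2 ^ k := by
      exact_mod_cast congrArg (Rat.cast (K := ℝ)) (hformula Q hQ k (by omega))
    rw [hcard, hf, mul_comm 4 k, mul_comm 3 k, mul_comm 2 k, pow_mul, pow_mul, pow_mul] at h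
    push_cast at h
    rw [one_div, inv_pow]
    have ht : (0 : ℝ) < 2 ^ k := by positivity
    generalize (2 : ℝ) ^ k = t at h ht
    have h' := mul_le_mul_of_nonneg_right h (by positivity : 0 ≤ (t⁻¹) ^ 4)
    have e1 : (cr2K n : ℝ) * (m * t - 3) ^ 4 * t⁻¹ ^ 4 = cr2K n * (m - 3 * t⁻¹) ^ 4 := by
      field_simp
    have e2 : 24 * (a * t ^ 4 + b * t ^ 3 + c * t ^ 2 + d * t) * (n.choose 4 : ℝ) * t⁻¹ ^ 4 =
        24 * (a + b * t⁻¹ + c * t⁻¹ ^ 2 + d * t⁻¹ ^ 3) * n.choose 4 := by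
      field_simp
    rwa [e1, e2] at h'
  have hlim := le_of_tendsto_of_tendsto hl hr hle
  rw [div_mul_eq_mul_div, le_div_iff₀ (by positivity)]
  linarith
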